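/- **Model.** Let $a\in\mathbb N$ groups with fixed numbers $t_1,\dots,t_a$ of time points be given, $T=\sum_i t_i$. For $m=1,2,\dots$ let $n_1,\dots,n_a$ (depending on $m$) be group sizes, $N=\sum_i n_i$, with $\min_i n_i\to\infty$ and $n_i/N\to\kappa_i>0$ as $m\to\infty$ (so $\kappa_i\in(0,1)$ if $a\ge 2$). For each $m$ let $\boldsymbol Y_{ik}$ ($1\le i\le a$, $1\le k\le n_i$) be independent random vectors in $\mathbb R^{t_i}$, where the vectors of group $i$ have a common distribution $F_i$ with expectation $\boldsymbol\mu_i$ and covariance matrix $\boldsymbol V_i>0$. The matrices $\boldsymbol V_i$ do not depend on $m$; the $F_i$ and $\boldsymbol\mu=(\boldsymbol\mu_1',\dots,\boldsymbol\mu_a')'$ may depend on $m$, provided that $\sup_m\max_i E\|\boldsymbol Y_{i1}-\boldsymbol\mu_i\|^4<\infty$ (for $F_i$ not depending on $m$ this says $E\|\boldsymbol Y_{i1}\|^4<\infty$). Let $\overline{\boldsymbol Y}_{i\cdot}=\frac1{n_i}\sum_k\boldsymbol Y_{ik}$, $\overline{\boldsymbol Y}_\cdot=(\overline{\boldsymbol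 Y}_{1\cdot}',\dots,\overline{\boldsymbol Y}_{a\cdot}')'$, $\widehat{\boldsymbol V}_i=\frac1{n_i-1}\sum_k(\boldsymbol Y_{ik}-\overline{\boldsymbol Y}_{i\cdot})(\boldsymbol Y_{ik}-\overline{\boldsymbol Y}_{i\cdot})'$, $\widehat{\boldsymbol\Sigma}=N\bigoplus_i\frac1{n_i}\widehat{\boldsymbol V}_i$ and $\boldsymbol\Sigma=\bigoplus_i\kappa_i^{-1}\boldsymbol V_i$. Let $\boldsymbol H$ be a real matrix with $T$ columns, $f=\operatorname{rank}(\boldsymbol H)$, and $$Q_N=N\,\overline{\boldsymbol Y}_\cdot'\boldsymbol H'(\boldsymbol H\widehat{\boldsymbol\Sigma}\boldsymbol H')^+\boldsymbol H\overline{\boldsymbol Y}_\cdot,\qquad \varphi=\mathbf 1\{Q_N>\chi^2_{f,1-\alpha}\},\quad \alpha\in(0,1),$$ where $(\cdot)^+$ is the Moore–Penrose inverse and $\chi^2_{f,1-\alpha}$ the $(1-\alpha)$-quantile of $\chi^2_f$ ($\chi^2_0$ is the point mass at $0$). **Theorem 2.2.** 1. *(Null hypothesis.)* If $\boldsymbol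 H\boldsymbol\mu=\boldsymbol 0$ (for all $m$), then $Q_N$ converges in distribution to the central $\chi^2_f$ distribution, and $\varphi$ is an asymptotic level $\alpha$ test: $E(\varphi)\to\alpha$ if $\boldsymbol H\ne\boldsymbol 0$ (and $E(\varphi)=0$ for all $m$ in the degenerate case $\boldsymbol H=\boldsymbol 0$). 2. *(Fixed alternatives.)* If $\boldsymbol\mu$ does not depend on $m$ and $\boldsymbol H\boldsymbol\mu\neq\boldsymbol 0$, then $E(\varphi)\to1$. 3. *(Local alternatives.)* If $\boldsymbol H\boldsymbol\mu=\frac1{\sqrt N}\boldsymbol H\boldsymbol\nu$ for all $m$, with a fixed $\boldsymbol\nu\in\mathbb R^T$, then $Q_N$ converges in distribution to the noncentral $\chi^2_f(\tilde\delta)$ distribution with $\tilde\delta=(\boldsymbol H\boldsymbol\nu)'(\boldsymbol H\boldsymbol\Sigma\boldsymbol H')^+\boldsymbol H\boldsymbol\nu$, and $E(\varphi)\to P(Z>\chi^2_{f,1-\alpha})$ with $Z\sim\chi^2_f(\tilde\delta)$. -/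

import Mathlib

open MeasureTheory ProbabilityTheory Filter Topology Matrix
open scoped NNReal ENNReal

noncomputable section

namespace WTS

/-! ### The Moore-Penrose inverse of a real matrix -/

section MoorePenrose

variable {m n : Type*} [Fintype m] [Fintype n]

/-- The four Penrose equations: `B` is the Moore-Penrose inverse of the real matrix `A`. -/
structure IsMoorePenrose (A : Matrix m n ℝ) (B : Matrix n m ℝ) : Prop where
  mul_mul_self : A * B * A = A
  self_mul_mul : B * A * B = B
  left_symm : (A * B)ᵀ = A * B
  right_symm : (B * A)ᵀ = B * A

theorem IsMoorePenrose.unique {A : Matrix m n ℝ} {B C : Matrix n m ℝ}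
    (hB : IsMoorePenrose A B) (hC : IsMoorePenrose A C) : B = C := by
  have h1 : A * B = A * C := by
    have e : (A * B) * (A * C) = A * C := by
      rw [← Matrix.mul_assoc, hB.mul_mul_self]
    have e' : (A * C) * (A * B) = A * B := by
      rw [← Matrix.mul_assoc, hC.mul_mul_self]
    have := congrArg Matrix.transpose e
    rw [Matrix.transpose_mul, hB.left_symm, hC.left_symm, e'] at this
    exact this
  have h2 : B * A = C * A := by
    have e : (B * A) * (C * A) = B * A := by
      rw [Matrix.mul_assoc, ← Matrix.mul_assoc A, hC.mul_mul_self]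
    have e' : (C * A) * (B * A) = C * A := by
      rw [Matrix.mul_assoc, ← Matrix.mul_assoc A, hB.mul_mul_self]
    have := congrArg Matrix.transpose e
    rw [Matrix.transpose_mul, hB.right_symm, hC.right_symm, e'] at this
    exact this.symm
  calc B = B * A * B := hB.self_mul_mul.symm
    _ = C * A * B := by rw [h2]
    _ = C * (A * C) := by rw [Matrix.mul_assoc, h1]
    _ = C := by rw [← Matrix.mul_assoc, hC.self_mul_mul]

theorem exists_isMoorePenrose [DecidableEq n] (A : Matrix m n ℝ) :
    ∃ B : Matrix n m ℝ, IsMoorePenrose A B := by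
  have hG : IsSelfAdjoint (Aᵀ * A) := by
    change star (Aᵀ * A) = _
    rw [Matrix.star_eq_conjTranspose, Matrix.conjTranspose_eq_transpose_of_trivial,
      Matrix.transpose_mul, Matrix.transpose_transpose]
  set G := Aᵀ * A with hGdef
  have hfin : (spectrum ℝ G).Finite := Matrix.finite_real_spectrum
  have hc : ∀ f : ℝ → ℝ, ContinuousOn f (spectrum ℝ G) := fun f => hfin.continuousOn f
  set K : Matrix n n ℝ := cfc (fun x : ℝ => x⁻¹) G with hK
  have hid : cfc (fun x : ℝ => x) G = G := cfc_id' ℝ G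
  have hKG : K * G = cfc (fun x : ℝ => x⁻¹ * x) G := by
    rw [cfc_mul (fun x : ℝ => x⁻¹) (fun x : ℝ => x) G (hc _) (hc _), hid]
  have hGKG : G * (K * G) = G := by
    have : cfc (fun x : ℝ => x * (x⁻¹ * x)) G = G := by
      rw [← hid]
      conv_lhs => rw [hid]
      congr 1
      funext x
      by_cases hx : x = 0 <;> simp [hx]
    rw [cfc_mul (fun x : ℝ => x) (fun x : ℝ => x⁻¹ * x) G (hc _) (hc _), hid, ← hKG] at this
    exact this
  have hKGK : K * G * K = K := by
    rw [hKG, hK, ← cfc_mul (fun x : ℝ => x⁻¹ * x) (fun x : ℝ => x⁻¹) G (hc _) (hc _)]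
    congr 1
    funext x
    by_cases hx : x = 0 <;> simp [hx]
  have symm_of : ∀ f : ℝ → ℝ, (cfc f G)ᵀ = cfc f G := by
    intro f
    have : IsSelfAdjoint (cfc f G) := cfc_predicate f G
    have h : star (cfc f G) = cfc f G := this
    rwa [Matrix.star_eq_conjTranspose, Matrix.conjTranspose_eq_transpose_of_trivial] at h
  have hKs : Kᵀ = K := symm_of _
  have hKGs : (K * G)ᵀ = K * G := by rw [hKG]; exact symm_of _
  have hA : A * (K * G) = A := by
    have h0 : (A * (K * G) - A)ᴴ * (A * (K * G) - A) = 0 := by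
      rw [Matrix.conjTranspose_eq_transpose_of_trivial, Matrix.transpose_sub,
        Matrix.transpose_mul, hKGs, Matrix.sub_mul, Matrix.mul_sub, Matrix.mul_sub,
        Matrix.mul_assoc (K * G) Aᵀ, Matrix.mul_assoc (K * G) Aᵀ, ← Matrix.mul_assoc Aᵀ A,
        ← hGdef, hGKG]
      simp
    exact sub_eq_zero.mp (Matrix.conjTranspose_mul_self_eq_zero.mp h0)
  refine ⟨K * Aᵀ, ?_, ?_, ?_, ?_⟩
  · rw [Matrix.mul_assoc A, Matrix.mul_assoc K, ← hGdef, hA]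
  · rw [Matrix.mul_assoc K, ← hGdef, ← Matrix.mul_assoc, hKGK]
  · rw [Matrix.transpose_mul, Matrix.transpose_mul, Matrix.transpose_transpose, hKs,
      Matrix.mul_assoc]
  · rw [Matrix.mul_assoc, ← hGdef, hKGs]

/-- The Moore-Penrose inverse `A⁺`, the unique solution of the four Penrose equations. -/
def moorePenrose [DecidableEq n] (A : Matrix m n ℝ) : Matrix n m ℝ :=
  Classical.choose (exists_isMoorePenrose A)

theorem isMoorePenrose_moorePenrose [DecidableEq n] (A : Matrix m n ℝ) :
    IsMoorePenrose A (moorePenrose A) :=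
  Classical.choose_spec (exists_isMoorePenrose A)

end MoorePenrose

/-! ### Chi-squared distributions and quantiles -/

/-- The central `χ²_f` distribution: the law of `X₁² + ⋯ + X_f²` for independent standard normal
`X₁, …, X_f` (the point mass at `0` for `f = 0`). -/
def chiSq (f : ℕ) : Measure ℝ :=
  (Measure.pi fun _ : Fin f => gaussianReal 0 1).map fun x => ∑ j, x j ^ 2

/-- The noncentral `χ²_f(δ)` distribution with noncentrality parameter `δ ≥ 0`: the law of
`X₁² + ⋯ + X_f²` for independent `X_j ∼ N(θ_j, 1)` with `θ₁² + ⋯ + θ_f² = δ`.  This law depends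
on `θ` only through `δ`; we take `θ = (√δ, 0, …, 0)`. -/
def noncentralChiSq (f : ℕ) (δ : ℝ) : Measure ℝ :=
  (Measure.pi fun j : Fin f => gaussianReal (if (j : ℕ) = 0 then √δ else 0) 1).map
    fun x => ∑ j, x j ^ 2

instance (f : ℕ) : IsProbabilityMeasure (chiSq f) :=
  Measure.isProbabilityMeasure_map
    (Measurable.aemeasurable (Finset.measurable_sum _ fun j _ => (measurable_pi_apply j).pow_const 2))

instance (f : ℕ) (δ : ℝ) : IsProbabilityMeasure (noncentralChiSq f δ) :=
  Measure.isProbabilityMeasure_map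
    (Measurable.aemeasurable (Finset.measurable_sum _ fun j _ => (measurable_pi_apply j).pow_const 2))

theorem noncentralChiSq_zero (f : ℕ) : noncentralChiSq f 0 = chiSq f := by
  simp [noncentralChiSq, chiSq]

/-- The `p`-quantile `inf {x | p ≤ ρ((-∞, x])}` of a distribution `ρ` on the real line. -/
def quantile (ρ : Measure ℝ) (p : ℝ) : ℝ := sInf {x : ℝ | p ≤ cdf ρ x}

/-! ### The repeated measures model

There are `a` groups; group `i` has `t i` time points and `n i` subjects.  A data set `y` consists
of the vectors `y i k ∈ ℝ^{t i}` for groups `i` and subjects `k`.  Stacked vectors are indexed by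
the pairs `⟨i, s⟩` of a group `i` and a time point `s`. -/

section Model

variable {a : ℕ} {t : Fin a → ℕ} {n : Fin a → ℕ}

/-- The total number `N = n₁ + ⋯ + n_a` of subjects. -/
def totalSize (n : Fin a → ℕ) : ℕ := ∑ i, n i

/-- The mean vector `Ȳ_{i·}` of group `i`. -/
def groupMean (y : ∀ i, Fin (n i) → Fin (t i) → ℝ) (i : Fin a) : Fin (t i) → ℝ :=
  fun s => (∑ k, y i k s) / (n i : ℝ)

/-- The stacked vector `Ȳ` of the group means. -/
def stackedMean (y : ∀ i, Fin (n i) → Fin (t i) → ℝ) : ((i : Fin a) × Fin (t i)) → ℝ :=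
  fun p => groupMean y p.1 p.2

/-- The sample covariance matrix `V̂ᵢ` of group `i`. -/
def sampleCov (y : ∀ i, Fin (n i) → Fin (t i) → ℝ) (i : Fin a) :
    Matrix (Fin (t i)) (Fin (t i)) ℝ :=
  ((n i : ℝ) - 1)⁻¹ •
    ∑ k, Matrix.vecMulVec (y i k - groupMean y i) (y i k - groupMean y i)

/-- `Σ̂ = N ⨁ᵢ nᵢ⁻¹ V̂ᵢ`. -/
def covEstimator (y : ∀ i, Fin (n i) → Fin (t i) → ℝ) :
    Matrix ((i : Fin a) × Fin (t i)) ((i : Fin a) × Fin (t i)) ℝ :=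
  (totalSize n : ℝ) • Matrix.blockDiagonal' fun i => (n i : ℝ)⁻¹ • sampleCov y i

/-- `Σ = ⨁ᵢ κᵢ⁻¹ Vᵢ`. -/
def limitCov (κ : Fin a → ℝ) (V : ∀ i, Matrix (Fin (t i)) (Fin (t i)) ℝ) :
    Matrix ((i : Fin a) × Fin (t i)) ((i : Fin a) × Fin (t i)) ℝ :=
  Matrix.blockDiagonal' fun i => (κ i)⁻¹ • V i

/-- The Wald-type statistic `Q_N = N Ȳ' H' (H Σ̂ H')⁺ H Ȳ`. -/
def waldStat {r : ℕ} (H : Matrix (Fin r) ((i : Fin a) × Fin (t i)) ℝ)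
    (y : ∀ i, Fin (n i) → Fin (t i) → ℝ) : ℝ :=
  (totalSize n : ℝ) *
    ((H *ᵥ stackedMean y) ⬝ᵥ
      (moorePenrose (H * covEstimator y * Hᵀ) *ᵥ (H *ᵥ stackedMean y)))

/-- The critical value `χ²_{f, 1-α}` with `f = rank H`. -/
def criticalValue {r : ℕ} (H : Matrix (Fin r) ((i : Fin a) × Fin (t i)) ℝ) (α : ℝ) : ℝ :=
  quantile (chiSq H.rank) (1 - α)

open Classical in
/-- The Wald-type test `1{Q_N > χ²_{f, 1-α}}`. -/
def waldTest {r : ℕ} (H : Matrix (Fin r) ((i : Fin a) × Fin (t i)) ℝ) (α : ℝ)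
    (y : ∀ i, Fin (n i) → Fin (t i) → ℝ) : ℝ :=
  if criticalValue H α < waldStat H y then 1 else 0

/-- The noncentrality parameter `δ̃ = (Hν)' (H Σ H')⁺ Hν`. -/
def noncentrality {r : ℕ} (H : Matrix (Fin r) ((i : Fin a) × Fin (t i)) ℝ)
    (S : Matrix ((i : Fin a) × Fin (t i)) ((i : Fin a) × Fin (t i)) ℝ)
    (ν : ((i : Fin a) × Fin (t i)) → ℝ) : ℝ :=
  (H *ᵥ ν) ⬝ᵥ (moorePenrose (H * S * Hᵀ) *ᵥ (H *ᵥ ν))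

/-- The random vectors `Y i k` are independent, and those of group `i` have distribution `F i`, a
probability measure on `ℝ^{t i}` with expectation `(μ ⟨i, s⟩)_s` and covariance matrix `V i`. -/
structure IsRepeatedMeasuresSample {Ω : Type*} [MeasurableSpace Ω] (P : Measure Ω)
    (Y : ∀ i, Fin (n i) → Ω → Fin (t i) → ℝ)
    (F : ∀ i, Measure (Fin (t i) → ℝ)) (μ : ((i : Fin a) × Fin (t i)) → ℝ)
    (V : ∀ i, Matrix (Fin (t i)) (Fin (t i)) ℝ) : Prop where
  indep : iIndepFun (fun p : (i : Fin a) × Fin (n i) => Y p.1 p.2) P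
  hasLaw : ∀ i k, HasLaw (Y i k) (F i) P
  isProbabilityMeasure : ∀ i, IsProbabilityMeasure (F i)
  integrable : ∀ i s, Integrable (fun x : Fin (t i) → ℝ => x s) (F i)
  mean : ∀ i s, ∫ x, x s ∂(F i) = μ ⟨i, s⟩
  covariance : ∀ i s s',
    ∫ x, (x s - μ ⟨i, s⟩) * (x s' - μ ⟨i, s'⟩) ∂(F i) = V i s s'

end Model

end WTS

end

/-! Write `H = B * C` through dimension `f = rank H`, where `B` has a left inverse `A` and `C`
whitens the limit covariance, `C * Σ * Cᵀ = 1` (`exists_whitening_factorization`). With `X = √N C Ȳ`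
the statistic is the quadratic form `X' W X`, where `W = Bᵀ (H Σ̂ Hᵀ)⁺ B`.

The Moore-Penrose inverse is not continuous in general, but `W` is harmless: as soon as `C Σ̂ Cᵀ` is
invertible, `W` is its ordinary inverse (`transpose_mul_moorePenrose_mul`). Bounded fourth moments
and Chebyshev's inequality give `Σ̂ → Σ` in probability, so this happens with probability tending to
one and `W → 1` in probability.

Under `H μ = N^(-1/2) H ν` the vector `X` tends in law to `η + Z`, with `η = C ν` and `Z` standard
Gaussian. The proof is by characteristic functions: a third-order Taylor bound, uniform over the
triangular array, replaces Lindeberg's condition (`tendsto_charFun_pow`). Slutsky's theorem yields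
the limit `‖η + Z‖²`, which by rotation invariance depends on `η` only through `‖η‖²`, the
noncentrality parameter. The null hypothesis is the case `ν = 0`.

For `f > 0` the limit law has no atoms, so rejection probabilities converge by the portmanteau
theorem; `f = 0` forces `H = 0` and is treated directly. At a fixed alternative `Q_N / N` tends in
probability to `‖C μ‖² > 0`, so `Q_N` passes every bound. -/

namespace WTS

/-! ### Convergence in probability as a filter, and Slutsky's theorem -/

section InProbability

variable {Ω : ℕ → Type*} [∀ m, MeasurableSpace (Ω m)]

/-- The filter of convergence in probability for a sequence of probability spaces: a set belongs to
it if the probabilities of the sections of its complement tend to zero. -/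
def inProb (P : ∀ m, Measure (Ω m)) : Filter (Σ m, Ω m) where
  sets := {A | Tendsto (fun m => P m {ω | ⟨m, ω⟩ ∉ A}) atTop (𝓝 0)}
  univ_sets := by simp
  sets_of_superset {A B} hA hAB := by
    refine tendsto_of_tendsto_of_tendsto_of_le_of_le tendsto_const_nhds hA (fun _ => zero_le)
      fun m => measure_mono fun ω hω h => hω (hAB h)
  inter_sets {A B} hA hB := by
    have h : Tendsto (fun m => P m {ω | ⟨m, ω⟩ ∉ A} + P m {ω | ⟨m, ω⟩ ∉ B}) atTop (𝓝 0) := by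
      simpa using Tendsto.add hA hB
    refine tendsto_of_tendsto_of_tendsto_of_le_of_le tendsto_const_nhds h (fun _ => zero_le)
      fun m => ?_
    refine (measure_mono ?_).trans (measure_union_le _ _)
    intro ω hω
    by_contra hc
    simp only [Set.mem_union, Set.mem_ofPred_eq, not_or, not_not] at hc
    exact hω hc

variable {P : ∀ m, Measure (Ω m)}

theorem eventually_inProb {p : (Σ m, Ω m) → Prop} :
    (∀ᶠ x in inProb P, p x) ↔ Tendsto (fun m => P m {ω | ¬ p ⟨m, ω⟩}) atTop (𝓝 0) := Iff.rfl

theorem tendsto_fst_inProb : Tendsto (fun x : Σ m, Ω m => x.1) (inProb P) atTop := by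
  refine tendsto_atTop.2 fun k => eventually_inProb.2 ?_
  refine tendsto_const_nhds.congr' ?_
  filter_upwards [eventually_ge_atTop k] with m hm
  simp [hm]

theorem tendsto_inProb_nhds_real {X : ∀ m, Ω m → ℝ} {c : ℝ} :
    Tendsto (fun x : Σ m, Ω m => X x.1 x.2) (inProb P) (𝓝 c) ↔
      ∀ ε > 0, Tendsto (fun m => P m {ω | ε ≤ |X m ω - c|}) atTop (𝓝 0) := by
  simp only [Metric.tendsto_nhds, eventually_inProb, Real.dist_eq, not_lt, gt_iff_lt]

variable [∀ m, IsProbabilityMeasure (P m)]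

theorem tendsto_measureReal_of_eventually_inProb {p : (Σ m, Ω m) → Prop}
    (hm : ∀ m, NullMeasurableSet {ω | p ⟨m, ω⟩} (P m)) (h : ∀ᶠ x in inProb P, p x) :
    Tendsto (fun m => (P m).real {ω | p ⟨m, ω⟩}) atTop (𝓝 1) := by
  have h0 : Tendsto (fun m => (P m).real {ω | ¬ p ⟨m, ω⟩}) atTop (𝓝 0) := by
    exact (ENNReal.tendsto_toReal ENNReal.zero_ne_top).comp (eventually_inProb.1 h)
  have h1 := h0.const_sub 1
  rw [sub_zero] at h1
  refine h1.congr fun m => ?_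
  have := probReal_compl_eq_one_sub₀ (hm m)
  rw [Set.compl_ofPred] at this
  rw [this]; ring

/-- Convergence in distribution is a property of the laws. -/
theorem tendstoInDistribution_of_map_eq {ι E Ω' : Type*} {l : Filter ι} {Ω₁ Ω₂ : ι → Type*}
    [∀ i, MeasurableSpace (Ω₁ i)] [∀ i, MeasurableSpace (Ω₂ i)] [MeasurableSpace Ω']
    [TopologicalSpace E] [MeasurableSpace E] [OpensMeasurableSpace E]
    {P₁ : ∀ i, Measure (Ω₁ i)} {P₂ : ∀ i, Measure (Ω₂ i)} [∀ i, IsProbabilityMeasure (P₁ i)]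
    [∀ i, IsProbabilityMeasure (P₂ i)] {P' : Measure Ω'} [IsProbabilityMeasure P']
    {X : ∀ i, Ω₁ i → E} {Y : ∀ i, Ω₂ i → E} {Z : Ω' → E}
    (h : TendstoInDistribution X l Z P₁ P') (hY : ∀ i, AEMeasurable (Y i) (P₂ i))
    (hXY : ∀ i, (P₁ i).map (X i) = (P₂ i).map (Y i)) : TendstoInDistribution Y l Z P₂ P' where
  forall_aemeasurable := hY
  aemeasurable_limit := h.aemeasurable_limit
  tendsto := by
    refine h.tendsto.congr fun i => ?_
    exact Subtype.ext (hXY i)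

/-- Slutsky's theorem for a sequence of probability spaces. -/
theorem tendstoInDistribution_comp_of_inProb {E E' G Ω' : Type*}
    [SeminormedAddCommGroup E] [SecondCountableTopology E] [MeasurableSpace E] [BorelSpace E]
    [SeminormedAddCommGroup E'] [SecondCountableTopology E'] [MeasurableSpace E'] [BorelSpace E']
    [TopologicalSpace G] [MeasurableSpace G] [BorelSpace G] [MeasurableSpace Ω']
    {P' : Measure Ω'} [IsProbabilityMeasure P'] {g : E × E' → G} (hg : Continuous g)
    {X : ∀ m, Ω m → E} {Z : Ω' → E} {W : ∀ m, Ω m → E'} {c : E'}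
    (hX : TendstoInDistribution X atTop Z P P')
    (hW : ∀ m, AEMeasurable (W m) (P m))
    (hWc : Tendsto (fun x : Σ m, Ω m => W x.1 x.2) (inProb P) (𝓝 c)) :
    TendstoInDistribution (fun m ω => g (X m ω, W m ω)) atTop (fun z => g (Z z, c)) P P' := by
  -- Convergence in measure lives on a single space, so all models are realised together on the
  -- product space. The coupling is irrelevant, since hypotheses and conclusion depend only on the
  -- law for each `m`.
  have hmp := measurePreserving_eval_infinitePi P
  have hXm := hX.forall_aemeasurable
  have hX' : TendstoInDistribution (fun m (ω : ∀ m, Ω m) => X m (ω m)) atTop Z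
      (fun _ => Measure.infinitePi P) P' := by
    refine tendstoInDistribution_of_map_eq hX
      (fun m => (hXm m).comp_quasiMeasurePreserving (hmp m).quasiMeasurePreserving) fun m => ?_
    have := (hmp m).map_eq
    conv_lhs => rw [← this]
    rw [AEMeasurable.map_map_of_aemeasurable (by rw [this]; exact hXm m)
      (measurable_pi_apply m).aemeasurable]
    rfl
  have hW' : ∀ m, AEMeasurable (fun ω : ∀ m, Ω m => W m (ω m)) (Measure.infinitePi P) :=
    fun m => (hW m).comp_quasiMeasurePreserving (hmp m).quasiMeasurePreserving
  have hWc' : TendstoInMeasure (Measure.infinitePi P) (fun m (ω : ∀ m, Ω m) => W m (ω m)) atTop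
      (fun _ => c) := by
    rw [tendstoInMeasure_iff_norm]
    intro ε hε
    have h := (Metric.tendsto_nhds.1 hWc) ε hε
    rw [eventually_inProb] at h
    refine h.congr fun m => ?_
    simp only [not_lt, dist_eq_norm]
    have hs : NullMeasurableSet {ω | ε ≤ ‖W m ω - c‖} (P m) :=
      nullMeasurableSet_le aemeasurable_const (by have := hW m; fun_prop)
    exact ((hmp m).measure_preimage hs).symm
  have key := hX'.continuous_comp_prodMk_of_tendstoInMeasure_const hg hWc' hW'
  refine tendstoInDistribution_of_map_eq key
    (fun m => hg.measurable.comp_aemeasurable ((hXm m).prodMk (hW m))) fun m => ?_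
  have := (hmp m).map_eq
  have hgm : AEMeasurable (fun ω => g (X m ω, W m ω)) (P m) :=
    hg.measurable.comp_aemeasurable ((hXm m).prodMk (hW m))
  conv_rhs => rw [← this]
  rw [AEMeasurable.map_map_of_aemeasurable (by rw [this]; exact hgm)
      (measurable_pi_apply m).aemeasurable]
  rfl

end InProbability

/-! ### Moore-Penrose inverses and whitening -/

section MatrixLemmas

theorem eq_zero_of_rank_eq_zero {m n : Type*} [Fintype m] [Fintype n] {A : Matrix m n ℝ}
    (h : A.rank = 0) : A = 0 := by
  classical
  have h1 : LinearMap.range A.mulVecLin = ⊥ := Submodule.finrank_eq_zero.1 h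
  rw [LinearMap.range_eq_bot] at h1
  ext i j
  have := congrFun (LinearMap.congr_fun h1 (Pi.single j 1)) i
  simpa using this

/-- The Moore-Penrose inverse is a Borel measurable function of the matrix, because its graph is
closed. -/
theorem measurable_moorePenrose {m n : Type*} [Fintype m] [Fintype n] [DecidableEq n] :
    Measurable (fun A : m → n → ℝ => Matrix.of.symm (moorePenrose (Matrix.of A))) := by
  intro U hU
  let G : Set ((m → n → ℝ) × (n → m → ℝ)) :=
    {p | IsMoorePenrose (Matrix.of p.1) (Matrix.of p.2)}
  have hG : IsClosed G := by
    have h : G = {p | Matrix.of p.1 * Matrix.of p.2 * Matrix.of p.1 = Matrix.of p.1} ∩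
        {p | Matrix.of p.2 * Matrix.of p.1 * Matrix.of p.2 = Matrix.of p.2} ∩
        {p | (Matrix.of p.1 * Matrix.of p.2)ᵀ = Matrix.of p.1 * Matrix.of p.2} ∩
        {p | (Matrix.of p.2 * Matrix.of p.1)ᵀ = Matrix.of p.2 * Matrix.of p.1} := by
      ext p
      exact ⟨fun h => ⟨⟨⟨h.1, h.2⟩, h.3⟩, h.4⟩, fun h => ⟨h.1.1.1, h.1.1.2, h.1.2, h.2⟩⟩
    have c1 : Continuous fun p : (m → n → ℝ) × (n → m → ℝ) => Matrix.of p.1 := continuous_fst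
    have c2 : Continuous fun p : (m → n → ℝ) × (n → m → ℝ) => Matrix.of p.2 := continuous_snd
    have c12 := c1.matrix_mul c2
    have c21 := c2.matrix_mul c1
    rw [h]
    exact (((isClosed_eq (c12.matrix_mul c1) c1).inter (isClosed_eq (c21.matrix_mul c2) c2)).inter
      (isClosed_eq c12.matrix_transpose c12)).inter (isClosed_eq c21.matrix_transpose c21)
  have himg : (fun A : m → n → ℝ => Matrix.of.symm (moorePenrose (Matrix.of A))) ⁻¹' U =
      Prod.fst '' (G ∩ Prod.snd ⁻¹' U) := by
    ext A
    constructor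
    · intro hA
      exact ⟨(A, Matrix.of.symm (moorePenrose (Matrix.of A))), ⟨isMoorePenrose_moorePenrose _, hA⟩, rfl⟩
    · rintro ⟨⟨A', B⟩, ⟨hB, hBU⟩, rfl⟩
      have : moorePenrose (Matrix.of A') = Matrix.of B :=
        (isMoorePenrose_moorePenrose _).unique hB
      change Matrix.of.symm (moorePenrose (Matrix.of A')) ∈ U
      rw [this]
      exact hBU
  rw [himg]
  -- Lusin-Souslin: the projection is injective on the graph because each matrix has only one
  -- Moore-Penrose inverse, so the image of a Borel set is Borel.
  refine (hG.measurableSet.inter (measurable_snd hU)).image_of_continuousOn_injOn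
    continuous_fst.continuousOn ?_
  rintro ⟨A, B⟩ ⟨hB, -⟩ ⟨A', B'⟩ ⟨hB', -⟩ h
  obtain rfl : A = A' := h
  exact Prod.ext rfl (IsMoorePenrose.unique hB hB')

/-- Sandwiched between injective factors, a generalised inverse of `B * M * Bᵀ` is `M⁻¹`. -/
theorem transpose_mul_moorePenrose_mul {r f : Type*} [Fintype r] [DecidableEq r] [Fintype f]
    [DecidableEq f] {A : Matrix f r ℝ} {B : Matrix r f ℝ} (hAB : A * B = 1) {M : Matrix f f ℝ}
    (hM : IsUnit M.det) : Bᵀ * moorePenrose (B * M * Bᵀ) * B = M⁻¹ := by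
  -- This Penrose equation suffices: multiplying by `A` on the left and `Aᵀ` on the right cancels
  -- the outer factors `B` and `Bᵀ`.
  have h := (isMoorePenrose_moorePenrose (B * M * Bᵀ)).mul_mul_self
  have hBA : Bᵀ * Aᵀ = 1 := by rw [← Matrix.transpose_mul, hAB, Matrix.transpose_one]
  have h2 : M * (Bᵀ * moorePenrose (B * M * Bᵀ) * B) * M = M := by
    have := congrArg (fun X => A * X * Aᵀ) h
    set W := moorePenrose (B * M * Bᵀ)
    calc M * (Bᵀ * W * B) * M = (A * B) * M * (Bᵀ * W * B) * M * (Bᵀ * Aᵀ) := by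
          rw [hAB, hBA]; simp
      _ = A * (B * M * Bᵀ * W * (B * M * Bᵀ)) * Aᵀ := by simp only [Matrix.mul_assoc]
      _ = (A * B) * M * (Bᵀ * Aᵀ) := by rw [this]; simp only [Matrix.mul_assoc]
      _ = M := by rw [hAB, hBA]; simp
  set W := Bᵀ * moorePenrose (B * M * Bᵀ) * B
  calc W = M⁻¹ * (M * W * M) * M⁻¹ := by
        rw [Matrix.mul_assoc M, ← Matrix.mul_assoc M⁻¹, Matrix.nonsing_inv_mul _ hM,
          Matrix.one_mul, Matrix.mul_assoc, Matrix.mul_nonsing_inv _ hM, Matrix.mul_one]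
    _ = M⁻¹ := by rw [h2, Matrix.nonsing_inv_mul _ hM, Matrix.one_mul]

/-- The rows of a real matrix lie in the span of `rank K` orthonormal vectors. -/
theorem exists_orthonormal_rows {r T : Type*} [Fintype r] [Fintype T] (K : Matrix r T ℝ) :
    ∃ D : Matrix (Fin K.rank) T ℝ, D * Dᵀ = 1 ∧ K * Dᵀ * D = K := by
  classical
  let U : Submodule ℝ (EuclideanSpace ℝ T) := Submodule.span ℝ (Set.range fun i => WithLp.toLp 2 (K i))
  have hU : Module.finrank ℝ U = K.rank := by
    rw [Matrix.rank_eq_finrank_span_row]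
    have : U = (Submodule.span ℝ (Set.range K.row)).map
        (WithLp.linearEquiv 2 ℝ (T → ℝ)).symm.toLinearMap := by
      rw [Submodule.map_span, ← Set.range_comp]
      rfl
    rw [this]
    exact LinearEquiv.finrank_map_eq _ _
  let b : OrthonormalBasis (Fin K.rank) ℝ U :=
    (stdOrthonormalBasis ℝ U).reindex (finCongr hU)
  refine ⟨Matrix.of fun j s => (b j : EuclideanSpace ℝ T) s, ?_, ?_⟩
  · ext i j
    have h := orthonormal_iff_ite.1 b.orthonormal i j
    rw [Submodule.coe_inner, PiLp.inner_apply] at h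
    rw [Matrix.mul_apply, Matrix.one_apply]
    simp only [Matrix.transpose_apply, Matrix.of_apply]
    rw [← h]
    exact Finset.sum_congr rfl fun s _ => by simp [mul_comm]
  · ext i s
    let x : U := ⟨WithLp.toLp 2 (K i), Submodule.subset_span ⟨i, rfl⟩⟩
    have h := congrArg (fun y : U => (y : EuclideanSpace ℝ T) s) (b.sum_repr' x)
    simp only [Submodule.coe_sum, Submodule.coe_smul, Submodule.coe_inner, x] at h
    rw [Matrix.mul_apply]
    rw [← show _ = K i s from h]
    simp [Matrix.mul_apply, PiLp.inner_apply, mul_comm]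

/-- Rank factorisation of `H` whose right factor whitens a positive definite matrix. -/
theorem exists_whitening_factorization {r T : Type*} [Fintype r] [Fintype T] [DecidableEq T]
    (H : Matrix r T ℝ) {S : Matrix T T ℝ} (hS : S.PosDef) :
    ∃ (A : Matrix (Fin H.rank) r ℝ) (B : Matrix r (Fin H.rank) ℝ) (C : Matrix (Fin H.rank) T ℝ),
      A * B = 1 ∧ B * C = H ∧ C * S * Cᵀ = 1 := by
  -- With `S = yᵀ * y`, a matrix `D` with orthonormal rows gives `C = D * (yᵀ)⁻¹` and `C * S * Cᵀ =
  -- D * Dᵀ = 1`. Taking `D` from the row space of `H * yᵀ` keeps `H` recoverable from `C`.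
  obtain ⟨y, hy⟩ : ∃ y : Matrix T T ℝ, S = yᵀ * y := by
    open scoped MatrixOrder in
    obtain ⟨y, hy⟩ := CStarAlgebra.nonneg_iff_eq_star_mul_self.mp hS.posSemidef.nonneg
    exact ⟨y, by simpa [Matrix.star_eq_conjTranspose] using hy⟩
  have hyd : IsUnit y.det := by
    have h := (Matrix.isUnit_iff_isUnit_det _).1 hS.isUnit
    rw [hy, Matrix.det_mul] at h
    exact isUnit_of_mul_isUnit_right h
  have hydt : IsUnit yᵀ.det := by rwa [Matrix.det_transpose]
  have hrank : (H * yᵀ).rank = H.rank := Matrix.rank_mul_eq_left_of_isUnit_det _ _ hydt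
  obtain ⟨D, hD1, hD2⟩ := exists_orthonormal_rows (H * yᵀ)
  revert D
  rw [hrank]
  intro D hD1 hD2
  have hBC : (H * yᵀ * Dᵀ) * (D * (yᵀ)⁻¹) = H := by
    rw [← Matrix.mul_assoc, hD2, Matrix.mul_assoc, Matrix.mul_nonsing_inv _ hydt, Matrix.mul_one]
  set B := H * yᵀ * Dᵀ with hB
  -- `B` has `rank H` columns and cannot have smaller rank than `B * C = H`. So its Gram matrix is
  -- invertible, which supplies the left inverse `(Bᵀ * B)⁻¹ * Bᵀ`.
  have hBr : (Bᵀ * B).rank = H.rank := by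
    rw [Matrix.rank_transpose_mul_self]
    refine le_antisymm ((Matrix.rank_le_card_width B).trans (by simp)) ?_
    conv_lhs => rw [← hBC]
    exact Matrix.rank_mul_le_left _ _
  have hBu : IsUnit (Bᵀ * B).det := by
    rw [← Matrix.isUnit_iff_isUnit_det, ← Matrix.mulVec_surjective_iff_isUnit,
      ← Matrix.coe_mulVecLin, ← LinearMap.range_eq_top]
    refine Submodule.eq_top_of_finrank_eq ?_
    rw [Module.finrank_fin_fun]
    exact hBr
  refine ⟨(Bᵀ * B)⁻¹ * Bᵀ, B, D * (yᵀ)⁻¹, ?_, hBC, ?_⟩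
  · rw [Matrix.mul_assoc, Matrix.nonsing_inv_mul _ hBu]
  · rw [hy, Matrix.transpose_mul, Matrix.transpose_nonsing_inv, Matrix.transpose_transpose]
    calc D * (yᵀ)⁻¹ * (yᵀ * y) * (y⁻¹ * Dᵀ)
        = D * ((yᵀ)⁻¹ * yᵀ) * (y * y⁻¹) * Dᵀ := by simp only [Matrix.mul_assoc]
      _ = 1 := by
        rw [Matrix.nonsing_inv_mul _ hydt, Matrix.mul_nonsing_inv _ hyd, Matrix.mul_one,
          Matrix.mul_one, hD1]

end MatrixLemmas

/-! ### Chi-squared laws, atoms and quantiles -/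

section ChiSquared

/-- The squared norm of a Gaussian vector with mean `η` and identity covariance matrix. -/
theorem map_norm_add_sq_stdGaussian {f : ℕ} (η : EuclideanSpace ℝ (Fin f)) :
    (stdGaussian (EuclideanSpace ℝ (Fin f))).map (fun z => ‖η + z‖ ^ 2) =
      noncentralChiSq f (‖η‖ ^ 2) := by
  let θ : EuclideanSpace ℝ (Fin f) :=
    WithLp.toLp 2 fun j : Fin f => if (j : ℕ) = 0 then √(‖η‖ ^ 2) else 0
  have hθ : ‖η‖ = ‖θ‖ := by
    rcases f with _ | k
    · rw [Subsingleton.elim η θ]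
    · rw [EuclideanSpace.norm_eq θ, Fin.sum_univ_succ]
      simp [θ]
  -- Vectors of equal norm are exchanged by the reflection in the hyperplane orthogonal to their
  -- difference, and this isometry preserves the standard Gaussian.
  let e := (ℝ ∙ (η - θ))ᗮ.reflection
  have he : e η = θ := Submodule.reflection_sub hθ
  have h1 : (fun z => ‖η + z‖ ^ 2) = (fun z => ‖θ + z‖ ^ 2) ∘ e := by
    funext z
    simp only [Function.comp_apply]
    rw [← he, ← map_add, e.norm_map]
  have hpi : (Measure.pi fun j : Fin f => gaussianReal (if (j : ℕ) = 0 then √(‖η‖ ^ 2) else 0) 1) =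
      (Measure.pi fun _ : Fin f => gaussianReal 0 1).map
        (fun (x : Fin f → ℝ) (j : Fin f) => x j + if (j : ℕ) = 0 then √(‖η‖ ^ 2) else 0) := by
    have hg : ∀ y : ℝ, (gaussianReal 0 1).map (fun x => x + y) = gaussianReal y 1 := fun y => by
      rw [gaussianReal_map_add_const, zero_add]
    rw [Measure.pi_map_pi (f := fun (j : Fin f) (x : ℝ) =>
      x + if (j : ℕ) = 0 then √(‖η‖ ^ 2) else 0) (hμ := fun j => by rw [hg]; infer_instance)
      (fun j => by fun_prop)]
    simp only [hg]
  rw [h1, ← Measure.map_map (by fun_prop) (by fun_prop), stdGaussian_map, noncentralChiSq, hpi,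
    ← map_pi_eq_stdGaussian, Measure.map_map (by fun_prop) (by fun_prop),
    Measure.map_map (by fun_prop) (by fun_prop)]
  congr 1
  funext x
  simp [EuclideanSpace.real_norm_sq_eq, θ, add_comm]

/-- By Fubini: once the other coordinates are fixed, at most two values of the first one solve the
equation, and the first factor has no atoms. -/
theorem pi_sum_sq_eq_zero {k : ℕ} (ρ : Fin (k + 1) → Measure ℝ) [∀ j, SigmaFinite (ρ j)]
    [NullSingletonClass (ρ 0)] (c : ℝ) : Measure.pi ρ {x | ∑ j, x j ^ 2 = c} = 0 := by
  have hmp := measurePreserving_piFinSuccAbove ρ 0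
  let S : Set (ℝ × (Fin k → ℝ)) := {p | p.1 ^ 2 + ∑ j, p.2 j ^ 2 = c}
  have hS : MeasurableSet S := measurableSet_eq_fun (by fun_prop) (by fun_prop)
  have hpre : {x : Fin (k + 1) → ℝ | ∑ j, x j ^ 2 = c} =
      (MeasurableEquiv.piFinSuccAbove (fun _ => ℝ) 0) ⁻¹' S := by
    ext x
    simp [S, Fin.sum_univ_succ, MeasurableEquiv.piFinSuccAbove, Fin.insertNthEquiv, Fin.tail]
  rw [hpre, hmp.measure_preimage hS.nullMeasurableSet, Measure.prod_apply_symm hS]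
  refine (lintegral_congr fun y => ?_).trans lintegral_zero
  refine Set.Finite.measure_zero (Set.Finite.subset
    (Set.toFinite {√(c - ∑ j, y j ^ 2), -√(c - ∑ j, y j ^ 2)}) ?_) _
  intro x hx
  have hx' : x ^ 2 + ∑ j, y j ^ 2 = c := hx
  have h2 : c - ∑ j, y j ^ 2 = x ^ 2 := by linarith
  rw [h2, Real.sqrt_sq_eq_abs]
  rcases abs_choice x with h | h <;> simp [h]

theorem nullSingletonClass_noncentralChiSq {f : ℕ} (hf : f ≠ 0) (δ : ℝ) : NullSingletonClass (noncentralChiSq f δ) := by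
  obtain ⟨k, rfl⟩ := Nat.exists_eq_succ_of_ne_zero hf
  refine ⟨fun c => ?_⟩
  have : NullSingletonClass (gaussianReal (if ((0 : Fin (k + 1)) : ℕ) = 0 then √δ else 0) 1) :=
    nullSingletonClass_gaussianReal one_ne_zero
  rw [noncentralChiSq, Measure.map_apply (by fun_prop) (measurableSet_singleton c)]
  exact pi_sum_sq_eq_zero
    (fun j : Fin (k + 1) => gaussianReal (if (j : ℕ) = 0 then √δ else 0) 1) c

theorem noncentralChiSq_zero_eq_dirac (δ : ℝ) : noncentralChiSq 0 δ = Measure.dirac 0 := by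
  rw [noncentralChiSq]
  simp only [Finset.univ_eq_empty, Finset.sum_empty]
  rw [Measure.map_const]
  simp

/-- Without atoms the cdf is continuous, so the infimum is attained, while all points to its left
have cdf below `p`; hence the cdf equals `p` there. The condition `0 < p < 1` makes the set nonempty
and bounded below, so that `sInf` is a genuine infimum. -/
theorem measureReal_Ioi_quantile {ρ : Measure ℝ} [IsProbabilityMeasure ρ] [NullSingletonClass ρ] {p : ℝ}
    (hp : p ∈ Set.Ioo (0 : ℝ) 1) : ρ.real (Set.Ioi (quantile ρ p)) = 1 - p := by
  have hcont : Continuous (cdf ρ) := by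
    rw [continuous_iff_continuousAt]
    intro x
    rw [(monotone_cdf ρ).continuousAt_iff_leftLim_eq_rightLim, StieltjesFunction.rightLim_eq]
    have h := (cdf ρ).measure_singleton x
    rw [measure_cdf, measure_singleton] at h
    have h2 := ENNReal.ofReal_eq_zero.1 h.symm
    exact le_antisymm ((monotone_cdf ρ).leftLim_le le_rfl) (by linarith)
  have hne : {x : ℝ | p ≤ cdf ρ x}.Nonempty :=
    (((tendsto_cdf_atTop ρ).eventually_const_lt hp.2).exists).imp fun x hx => hx.le
  have hbdd : BddBelow {x : ℝ | p ≤ cdf ρ x} := by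
    obtain ⟨x, hx⟩ := ((tendsto_cdf_atBot ρ).eventually_lt_const hp.1).exists
    refine ⟨x, fun y hy => ?_⟩
    by_contra! hlt
    exact absurd (le_trans hy (monotone_cdf ρ hlt.le)) (not_le.2 hx)
  have hclosed : IsClosed {x : ℝ | p ≤ cdf ρ x} := isClosed_le continuous_const hcont
  have h1 : p ≤ cdf ρ (quantile ρ p) := hclosed.csInf_mem hne hbdd
  have h2 : cdf ρ (quantile ρ p) ≤ p := by
    have hl : Tendsto (cdf ρ) (𝓝[<] (quantile ρ p)) (𝓝 (cdf ρ (quantile ρ p))) :=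
      hcont.continuousAt.tendsto.mono_left nhdsWithin_le_nhds
    refine le_of_tendsto hl ?_
    filter_upwards [self_mem_nhdsWithin] with x hx
    by_contra! hlt
    exact absurd (csInf_le hbdd (show x ∈ {x : ℝ | p ≤ cdf ρ x} from hlt.le)) (not_le.2 hx)
  rw [← Set.compl_Iic, probReal_compl_eq_one_sub measurableSet_Iic, ← cdf_eq_real,
    le_antisymm h2 h1]

/-- Serves the degenerate case: a statistic that is identically zero never exceeds the critical
value. -/
theorem quantile_chiSq_nonneg (f : ℕ) {p : ℝ} (hp : 0 < p) : 0 ≤ quantile (chiSq f) p := by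
  refine Real.sInf_nonneg fun x hx => ?_
  by_contra! hlt
  have h0 : cdf (chiSq f) x = 0 := by
    rw [cdf_eq_real, chiSq, map_measureReal_apply (by fun_prop) measurableSet_Iic]
    have : (fun x : Fin f → ℝ => ∑ j, x j ^ 2) ⁻¹' Set.Iic x = ∅ := by
      ext y
      simp only [Set.mem_preimage, Set.mem_Iic, Set.mem_empty_iff_false, iff_false, not_le]
      exact hlt.trans_le (Finset.sum_nonneg fun j _ => sq_nonneg _)
    rw [this, measureReal_empty]
  rw [Set.mem_ofPred_eq, h0] at hx
  linarith

end ChiSquared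

/-! ### A one-dimensional central limit theorem for triangular arrays -/

section CentralLimit

/-- A bound on the whole line, so that it can be integrated without truncation. For `|x| ≤ 1` it is
the exponential remainder; for `|x| > 1` every term is at most a multiple of `|x| ^ 3`, with
coefficients adding up to `7/2`. -/
theorem norm_exp_mul_I_sub_taylor_le (x : ℝ) :
    ‖Complex.exp (x * Complex.I) - (1 + x * Complex.I - x ^ 2 / 2)‖ ≤ 4 * |x| ^ 3 := by
  rcases le_or_gt |x| 1 with h | h
  · have hn : ‖(x * Complex.I : ℂ)‖ = |x| := by simp
    have hb := Complex.exp_bound (x := x * Complex.I) (by rw [hn]; exact h) (n := 3) (by norm_num)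
    rw [hn] at hb
    have hs : ∑ m ∈ Finset.range 3, ((x : ℂ) * Complex.I) ^ m / (m.factorial : ℂ) =
        1 + x * Complex.I - x ^ 2 / 2 := by
      simp only [Finset.sum_range_succ, Finset.sum_range_zero, Nat.factorial, mul_pow,
        Complex.I_sq]
      push_cast
      ring
    rw [hs] at hb
    refine hb.trans ?_
    have : (0 : ℝ) ≤ |x| ^ 3 := by positivity
    norm_num [Nat.factorial]
    linarith
  · have h1 : ‖Complex.exp (x * Complex.I)‖ = 1 := Complex.norm_exp_ofReal_mul_I x
    have h2 : ‖(1 + x * Complex.I - x ^ 2 / 2 : ℂ)‖ ≤ 1 + |x| + |x| ^ 2 / 2 := by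
      refine (norm_sub_le _ _).trans (add_le_add ((norm_add_le _ _).trans ?_) ?_)
      · simp
      · simp
    refine (norm_sub_le _ _).trans ?_
    rw [h1]
    have h3 : |x| ≤ |x| ^ 3 := le_self_pow₀ h.le (by norm_num)
    have h4 : |x| ^ 2 ≤ |x| ^ 3 := pow_le_pow_right₀ h.le (by norm_num)
    linarith

theorem norm_pow_sub_pow_le {z w : ℂ} (hz : ‖z‖ ≤ 1) (hw : ‖w‖ ≤ 1) (n : ℕ) :
    ‖z ^ n - w ^ n‖ ≤ n * ‖z - w‖ := by
  induction n with
  | zero => simp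
  | succ n ih =>
    have h : z ^ (n + 1) - w ^ (n + 1) = z ^ n * (z - w) + (z ^ n - w ^ n) * w := by ring
    rw [h]
    refine (norm_add_le _ _).trans ?_
    rw [norm_mul, norm_mul, norm_pow]
    have h1 : ‖z‖ ^ n ≤ 1 := pow_le_one₀ (norm_nonneg _) hz
    have h2 : ‖z‖ ^ n * ‖z - w‖ ≤ ‖z - w‖ := mul_le_of_le_one_left (norm_nonneg _) h1
    have h3 : ‖z ^ n - w ^ n‖ * ‖w‖ ≤ ‖z ^ n - w ^ n‖ := mul_le_of_le_one_right (norm_nonneg _) hw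
    push_cast
    linarith

/-- Integrating the pointwise Taylor bound leaves the third absolute moment, controlled through `|x|
^ 3 ≤ x ^ 2 + x ^ 4`. The error depends on the law only through `v` and `K`, hence is uniform over
an array. -/
theorem norm_charFun_sub_taylor_le {ρ : Measure ℝ} [IsProbabilityMeasure ρ] {v K : ℝ}
    (hint : Integrable (fun x : ℝ => x ^ 4) ρ) (h1 : ∫ x, x ∂ρ = 0) (h2 : ∫ x, x ^ 2 ∂ρ = v)
    (h4 : ∫ x, x ^ 4 ∂ρ ≤ K) (s : ℝ) :
    ‖charFun ρ s - (1 - s ^ 2 * v / 2 : ℝ)‖ ≤ 4 * |s| ^ 3 * (v + K) := by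
  have i2 : Integrable (fun x : ℝ => x ^ 2) ρ := by
    refine ((integrable_const (1 : ℝ)).add hint).mono' (by fun_prop) (ae_of_all _ fun x => ?_)
    rw [Real.norm_of_nonneg (sq_nonneg x)]
    simp only [Pi.add_apply]
    nlinarith [sq_nonneg (x ^ 2 - 1)]
  have i1 : Integrable (fun x : ℝ => x) ρ := by
    refine ((integrable_const (1 : ℝ)).add i2).mono' (by fun_prop) (ae_of_all _ fun x => ?_)
    simp only [Pi.add_apply, Real.norm_eq_abs]
    nlinarith [sq_nonneg (|x| - 1), sq_abs x]
  have i3 : Integrable (fun x : ℝ => x ^ 2 + x ^ 4) ρ := i2.add hint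
  have iexp : Integrable (fun x : ℝ => Complex.exp (s * x * Complex.I)) ρ := by
    refine (integrable_const (1 : ℝ)).mono' (by fun_prop) (ae_of_all _ fun x => ?_)
    rw [← Complex.ofReal_mul, Complex.norm_exp_ofReal_mul_I]
  have it : Integrable (fun x : ℝ => (1 + (s * x : ℝ) * Complex.I - ((s * x : ℝ) : ℂ) ^ 2 / 2)) ρ := by
    refine ((integrable_const (1 : ℂ)).add ?_).sub ?_
    · exact ((i1.const_mul s).ofReal (𝕜 := ℂ)).mul_const _
    · have := ((i2.const_mul (s ^ 2)).ofReal (𝕜 := ℂ)).div_const 2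
      refine this.congr (ae_of_all _ fun x => ?_)
      simp [mul_pow]
  have hT : ∫ x : ℝ, (1 + (s * x : ℝ) * Complex.I - ((s * x : ℝ) : ℂ) ^ 2 / 2) ∂ρ =
      ((1 - s ^ 2 * v / 2 : ℝ) : ℂ) := by
    have e : ∀ x : ℝ, (1 + (s * x : ℝ) * Complex.I - ((s * x : ℝ) : ℂ) ^ 2 / 2) =
        1 + ((s : ℂ) * Complex.I) * (x : ℂ) - ((s : ℂ) ^ 2 / 2) * ((x ^ 2 : ℝ) : ℂ) := by
      intro x; push_cast; ring
    simp only [e]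
    rw [integral_sub, integral_add, integral_const_mul, integral_const_mul, integral_complex_ofReal,
      integral_complex_ofReal, h1, h2]
    · simp; ring
    · exact integrable_const _
    · exact (i1.ofReal (𝕜 := ℂ)).const_mul _
    · exact (integrable_const _).add ((i1.ofReal (𝕜 := ℂ)).const_mul _)
    · exact (i2.ofReal (𝕜 := ℂ)).const_mul _
  rw [charFun_apply_real, ← hT, ← integral_sub iexp it]
  refine (norm_integral_le_of_norm_le (i3.const_mul (4 * |s| ^ 3)) (ae_of_all _ fun x => ?_)).trans ?_
  · have h := norm_exp_mul_I_sub_taylor_le (s * x)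
    rw [abs_mul, mul_pow] at h
    push_cast at h ⊢
    refine h.trans ?_
    have h3 : |x| ^ 3 ≤ x ^ 2 + x ^ 4 := by
      have e2 : x ^ 2 = |x| ^ 2 := (sq_abs x).symm
      have e4 : x ^ 4 = |x| ^ 4 := (Even.pow_abs (by decide) x).symm
      rw [e2, e4]
      nlinarith [sq_nonneg (|x| - 1), sq_nonneg (|x| * (|x| - 1)), sq_nonneg |x|, abs_nonneg x]
    rw [← mul_assoc]
    exact mul_le_mul_of_nonneg_left h3 (by positivity)
  · rw [integral_const_mul, integral_add i2 hint, h2]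
    exact mul_le_mul_of_nonneg_left (by linarith) (by positivity)

/-- Central limit theorem for triangular arrays with bounded fourth moments, in terms of
characteristic functions. -/
theorem tendsto_charFun_pow {ρ : ℕ → Measure ℝ} [∀ m, IsProbabilityMeasure (ρ m)] {v K w : ℝ}
    (hint : ∀ m, Integrable (fun x : ℝ => x ^ 4) (ρ m)) (h1 : ∀ m, ∫ x, x ∂(ρ m) = 0)
    (h2 : ∀ m, ∫ x, x ^ 2 ∂(ρ m) = v) (h4 : ∀ m, ∫ x, x ^ 4 ∂(ρ m) ≤ K)
    {n : ℕ → ℕ} {s : ℕ → ℝ} (hs : Tendsto s atTop (𝓝 0))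
    (hns : Tendsto (fun m => (n m : ℝ) * s m ^ 2) atTop (𝓝 w)) :
    Tendsto (fun m => charFun (ρ m) (s m) ^ n m) atTop (𝓝 (Complex.exp (-(w * v / 2 : ℝ)))) := by
  have hv : 0 ≤ v := by rw [← h2 0]; exact integral_nonneg fun x => sq_nonneg x
  have hlim : Tendsto (fun m => Complex.exp ((-(s m ^ 2 * v / 2) : ℝ)) ^ n m) atTop
      (𝓝 (Complex.exp (-(w * v / 2 : ℝ)))) := by
    have e : ∀ m, Complex.exp ((-(s m ^ 2 * v / 2) : ℝ)) ^ n m =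
        Complex.exp (((-((n m : ℝ) * s m ^ 2 * v / 2)) : ℝ) : ℂ) := by
      intro m
      rw [← Complex.exp_nat_mul]
      congr 1
      push_cast
      ring
    simp only [e]
    refine (Complex.continuous_exp.tendsto _).comp ?_
    rw [← Complex.ofReal_neg]
    refine (Complex.continuous_ofReal.tendsto _).comp ?_
    exact ((hns.mul_const v).div_const 2).neg
  have hdiff : Tendsto (fun m => charFun (ρ m) (s m) ^ n m -
      Complex.exp ((-(s m ^ 2 * v / 2) : ℝ)) ^ n m) atTop (𝓝 0) := by
    -- The `n`-th powers differ by at most `n` times the difference of the bases. That is `4 |s|³ (v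
    -- + K)` from the Taylor bound plus `(s² v / 2)²` from the real exponential; one factor `n s²`
    -- stays bounded and the rest vanishes.
    have hb : Tendsto (fun m => ((n m : ℝ) * s m ^ 2) *
        (4 * |s m| * (v + K) + s m ^ 2 * v ^ 2 / 4)) atTop (𝓝 0) := by
      have : Tendsto (fun m => 4 * |s m| * (v + K) + s m ^ 2 * v ^ 2 / 4) atTop (𝓝 0) := by
        have hc : Continuous fun y : ℝ => 4 * |y| * (v + K) + y ^ 2 * v ^ 2 / 4 := by fun_prop
        simpa [Function.comp_def] using (hc.tendsto 0).comp hs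
      simpa using hns.mul this
    have hsmall : ∀ᶠ m in atTop, s m ^ 2 * v / 2 < 1 := by
      have hc : Continuous fun y : ℝ => y ^ 2 * v / 2 := by fun_prop
      have : Tendsto (fun m => s m ^ 2 * v / 2) atTop (𝓝 0) := by
        simpa [Function.comp_def] using (hc.tendsto 0).comp hs
      exact this.eventually_lt_const one_pos
    refine squeeze_zero_norm' ?_ hb
    filter_upwards [hsmall] with m hm
    set x := s m ^ 2 * v / 2 with hx
    have hx0 : 0 ≤ x := by positivity
    have hw : ‖Complex.exp ((-x : ℝ))‖ ≤ 1 := by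
      rw [← Complex.ofReal_exp, Complex.norm_real, Real.norm_of_nonneg (Real.exp_pos _).le]
      exact Real.exp_le_one_iff.2 (by linarith)
    refine (norm_pow_sub_pow_le (norm_charFun_le_one _) hw (n m)).trans ?_
    have hA := norm_charFun_sub_taylor_le (hint m) (h1 m) (h2 m) (h4 m) (s m)
    have hB : ‖((1 - x : ℝ) : ℂ) - Complex.exp ((-x : ℝ))‖ ≤ x ^ 2 := by
      have := Real.abs_exp_sub_one_sub_id_le (x := -x) (by rw [abs_neg, abs_of_nonneg hx0]; exact hm.le)
      rw [← Complex.ofReal_exp, ← Complex.ofReal_sub, Complex.norm_real, Real.norm_eq_abs, abs_sub_comm]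
      have e : Real.exp (-x) - 1 - -x = Real.exp (-x) - (1 - x) := by ring
      rw [e] at this
      simpa using this
    have hAB := (norm_sub_le_norm_sub_add_norm_sub (charFun (ρ m) (s m)) ((1 - x : ℝ) : ℂ)
      (Complex.exp ((-x : ℝ)))).trans (add_le_add hA hB)
    refine (mul_le_mul_of_nonneg_left hAB (Nat.cast_nonneg _)).trans (le_of_eq ?_)
    have h3 : |s m| ^ 3 = s m ^ 2 * |s m| := by rw [← sq_abs (s m)]; ring
    rw [h3, hx]
    ring
  simpa using hdiff.add hlim

end CentralLimit

/-! ### Consequences of a bounded fourth moment -/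

section Moments

/-- A finite bound on the Lebesgue integral entails integrability, whereas a bound on the Bochner
integral would not: that integral is `0` for a non-integrable function. -/
theorem integrable_of_lintegral_ofReal_le {α : Type*} [MeasurableSpace α] {ρ : Measure α}
    {f : α → ℝ} (hf : Measurable f) (h0 : ∀ x, 0 ≤ f x) {C : ℝ≥0}
    (h : ∫⁻ x, ENNReal.ofReal (f x) ∂ρ ≤ C) : Integrable f ρ ∧ ∫ x, f x ∂ρ ≤ C := by
  refine ⟨⟨hf.aestronglyMeasurable, ?_⟩, ?_⟩
  · rw [hasFiniteIntegral_iff_ofReal (ae_of_all _ h0)]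
    exact h.trans_lt ENNReal.coe_lt_top
  · rw [integral_eq_lintegral_of_nonneg_ae (ae_of_all _ h0) hf.aestronglyMeasurable]
    exact ENNReal.toReal_le_coe_of_le_coe h

variable {t : ℕ} {ρ : Measure (Fin t → ℝ)} {c : Fin t → ℝ}

theorem sq_mul_sq_le_sq_sum_sq (z : Fin t → ℝ) (s s' : Fin t) :
    (z s * z s') ^ 2 ≤ (∑ j, z j ^ 2) ^ 2 := by
  have h1 : z s ^ 2 ≤ ∑ j, z j ^ 2 :=
    Finset.single_le_sum (f := fun j => z j ^ 2) (fun j _ => sq_nonneg _) (Finset.mem_univ s)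
  have h2 : z s' ^ 2 ≤ ∑ j, z j ^ 2 :=
    Finset.single_le_sum (f := fun j => z j ^ 2) (fun j _ => sq_nonneg _) (Finset.mem_univ s')
  rw [mul_pow, sq (∑ j, z j ^ 2)]
  exact mul_le_mul h1 h2 (sq_nonneg _) ((sq_nonneg _).trans h1)

theorem pow_four_dotProduct_le (u z : Fin t → ℝ) :
    (u ⬝ᵥ z) ^ 4 ≤ (∑ j, u j ^ 2) ^ 2 * (∑ j, z j ^ 2) ^ 2 := by
  have h : (u ⬝ᵥ z) ^ 2 ≤ (∑ j, u j ^ 2) * ∑ j, z j ^ 2 := Finset.sum_mul_sq_le_sq_mul_sq _ _ _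
  rw [← mul_pow]
  calc (u ⬝ᵥ z) ^ 4 = ((u ⬝ᵥ z) ^ 2) ^ 2 := by ring
    _ ≤ _ := pow_le_pow_left₀ (sq_nonneg _) h 2

theorem integrable_centered_mul [IsProbabilityMeasure ρ]
    (h4 : Integrable (fun x => (∑ s, (x s - c s) ^ 2) ^ 2) ρ) (s s' : Fin t) :
    Integrable (fun x => (x s - c s) * (x s' - c s')) ρ := by
  refine ((integrable_const (1 : ℝ)).add h4).mono' (by fun_prop) (ae_of_all _ fun x => ?_)
  have h := sq_mul_sq_le_sq_sum_sq (fun j => x j - c j) s s'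
  simp only [Pi.add_apply, Real.norm_eq_abs]
  rw [← sq_abs] at h
  nlinarith [sq_nonneg (|(x s - c s) * (x s' - c s')| - 1)]

theorem integrable_dotProduct_pow_four
    (h4 : Integrable (fun x => (∑ s, (x s - c s) ^ 2) ^ 2) ρ) (u : Fin t → ℝ) :
    Integrable (fun x => (u ⬝ᵥ (x - c)) ^ 4) ρ := by
  refine (h4.const_mul ((∑ j, u j ^ 2) ^ 2)).mono' ?_ (ae_of_all _ fun x => ?_)
  · exact (by simp only [dotProduct, Pi.sub_apply]; fun_prop : Measurable _).aestronglyMeasurable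
  · rw [Real.norm_of_nonneg (by positivity)]
    exact pow_four_dotProduct_le u (x - c)

theorem integral_dotProduct_pow_four_le {K : ℝ}
    (h4 : Integrable (fun x => (∑ s, (x s - c s) ^ 2) ^ 2) ρ)
    (hK : ∫ x, (∑ s, (x s - c s) ^ 2) ^ 2 ∂ρ ≤ K) (u : Fin t → ℝ) :
    ∫ x, (u ⬝ᵥ (x - c)) ^ 4 ∂ρ ≤ (∑ j, u j ^ 2) ^ 2 * K := by
  refine (integral_mono (integrable_dotProduct_pow_four h4 u)
    (h4.const_mul ((∑ j, u j ^ 2) ^ 2)) fun x => pow_four_dotProduct_le u (x - c)).trans ?_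
  rw [integral_const_mul]
  exact mul_le_mul_of_nonneg_left hK (by positivity)

theorem integral_dotProduct_centered [IsProbabilityMeasure ρ] (hint : ∀ s, Integrable (fun x : Fin t → ℝ => x s) ρ)
    (hc : ∀ s, ∫ x, x s ∂ρ = c s) (u : Fin t → ℝ) : ∫ x, u ⬝ᵥ (x - c) ∂ρ = 0 := by
  have hi : ∀ s, Integrable (fun x : Fin t → ℝ => u s * (x s - c s)) ρ :=
    fun s => ((hint s).sub (integrable_const _)).const_mul _
  simp only [dotProduct, Pi.sub_apply]
  rw [integral_finsetSum _ fun s _ => hi s]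
  refine Finset.sum_eq_zero fun s _ => ?_
  rw [integral_const_mul, integral_sub (hint s) (integrable_const _), hc s]
  simp

theorem integral_dotProduct_centered_sq [IsProbabilityMeasure ρ] {V : Matrix (Fin t) (Fin t) ℝ}
    (h4 : Integrable (fun x => (∑ s, (x s - c s) ^ 2) ^ 2) ρ)
    (hV : ∀ s s', ∫ x, (x s - c s) * (x s' - c s') ∂ρ = V s s') (u : Fin t → ℝ) :
    ∫ x, (u ⬝ᵥ (x - c)) ^ 2 ∂ρ = u ⬝ᵥ (V *ᵥ u) := by
  have e : ∀ x : Fin t → ℝ, (u ⬝ᵥ (x - c)) ^ 2 =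
      ∑ s, ∑ s', (u s * u s') * ((x s - c s) * (x s' - c s')) := by
    intro x
    rw [sq, dotProduct, Finset.sum_mul_sum]
    exact Finset.sum_congr rfl fun s _ => Finset.sum_congr rfl fun s' _ => by
      simp only [Pi.sub_apply]; ring
  simp only [e]
  rw [integral_finsetSum _ fun s _ => integrable_finsetSum _ fun s' _ =>
    (integrable_centered_mul h4 s s').const_mul _]
  simp only [dotProduct, Matrix.mulVec, Finset.mul_sum]
  refine Finset.sum_congr rfl fun s _ => ?_
  rw [integral_finsetSum _ fun s' _ => (integrable_centered_mul h4 s s').const_mul _]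
  refine Finset.sum_congr rfl fun s' _ => ?_
  rw [integral_const_mul, hV]
  ring

end Moments

/-! ### Consistency of the means and covariance estimators -/

section LawOfLargeNumbers

variable {Ω : ℕ → Type*} [∀ m, MeasurableSpace (Ω m)] {P : ∀ m, Measure (Ω m)}
  [∀ m, IsProbabilityMeasure (P m)]

/-- Weak law of large numbers for triangular arrays with bounded second moments. -/
theorem tendsto_average_inProb {n : ℕ → ℕ} (hn : Tendsto n atTop atTop)
    {X : ∀ m, Fin (n m) → Ω m → ℝ} {c K : ℝ} (hX : ∀ m k, MemLp (X m k) 2 (P m))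
    (hind : ∀ m, Pairwise fun k l => X m k ⟂ᵢ[P m] X m l)
    (hmean : ∀ m k, ∫ ω, X m k ω ∂(P m) = c) (hvar : ∀ m k, ∫ ω, X m k ω ^ 2 ∂(P m) ≤ K) :
    Tendsto (fun x : Σ m, Ω m => (∑ k, X x.1 k x.2) / (n x.1 : ℝ)) (inProb P) (𝓝 c) := by
  refine (tendsto_inProb_nhds_real (X := fun m ω => (∑ k, X m k ω) / (n m : ℝ))).2 fun ε hε => ?_
  -- Chebyshev's bound: by pairwise independence the sum has variance at most `n K`, compared with
  -- the squared deviation `(n ε) ^ 2`.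
  have hlim : Tendsto (fun m => ENNReal.ofReal (K / ε ^ 2 * ((n m : ℝ))⁻¹)) atTop (𝓝 0) := by
    have h := (tendsto_inv_atTop_zero.comp (tendsto_natCast_atTop_atTop.comp hn)).const_mul
      (K / ε ^ 2)
    rw [mul_zero] at h
    simpa using ENNReal.tendsto_ofReal h
  refine tendsto_of_tendsto_of_tendsto_of_le_of_le' tendsto_const_nhds hlim
    (Eventually.of_forall fun _ => zero_le) ?_
  filter_upwards [hn.eventually_gt_atTop 0] with m hm
  have hm' : (0 : ℝ) < n m := by exact_mod_cast hm
  have hS : MemLp (∑ k, X m k) 2 (P m) := memLp_finsetSum' _ fun k _ => hX m k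
  have hE : ∫ ω, (∑ k, X m k) ω ∂(P m) = n m * c := by
    simp only [Finset.sum_apply]
    rw [integral_finsetSum _ fun k _ => (hX m k).integrable one_le_two]
    simp [hmean]
  have hV : Var[∑ k, X m k; P m] ≤ n m * K := by
    rw [IndepFun.variance_sum (fun k _ => hX m k) fun k _ l _ hkl => hind m hkl]
    refine (Finset.sum_le_card_nsmul _ _ K fun k _ => ?_).trans (by simp)
    exact (variance_le_expectation_sq (hX m k).aestronglyMeasurable).trans (hvar m k)
  have hcheb := meas_ge_le_variance_div_sq hS (mul_pos hm' hε)
  rw [hE] at hcheb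
  refine (measure_mono ?_).trans (hcheb.trans (ENNReal.ofReal_le_ofReal ?_))
  · intro ω hω
    simp only [Set.mem_ofPred_eq, Finset.sum_apply] at hω ⊢
    have e : (∑ k, X m k ω) - n m * c = n m * ((∑ k, X m k ω) / (n m : ℝ) - c) := by
      field_simp
    rw [e, abs_mul, abs_of_pos hm']
    exact mul_le_mul_of_nonneg_left hω hm'.le
  · calc Var[∑ k, X m k; P m] / (n m * ε) ^ 2 ≤ n m * K / (n m * ε) ^ 2 := by gcongr
      _ = K / ε ^ 2 * (n m : ℝ)⁻¹ := by field_simp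

variable {a : ℕ} {t : Fin a → ℕ} {n : ℕ → Fin a → ℕ}
  {V : ∀ i, Matrix (Fin (t i)) (Fin (t i)) ℝ}
  {Y : ∀ m i, Fin (n m i) → Ω m → Fin (t i) → ℝ} {F : ℕ → ∀ i, Measure (Fin (t i) → ℝ)}
  {μ : ℕ → ((i : Fin a) × Fin (t i)) → ℝ}

/-- Weak law of large numbers for a function of the observations of one group. -/
theorem tendsto_groupAverage_inProb (hn : ∀ i, Tendsto (fun m => n m i) atTop atTop)
    (hY : ∀ m, IsRepeatedMeasuresSample (P m) (Y m) (F m) (μ m) V) (i : Fin a)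
    {g : ℕ → (Fin (t i) → ℝ) → ℝ} (hg : ∀ m, Measurable (g m)) {c K : ℝ}
    (hint : ∀ m, Integrable (fun x => g m x ^ 2) (F m i)) (hmean : ∀ m, ∫ x, g m x ∂(F m i) = c)
    (hvar : ∀ m, ∫ x, g m x ^ 2 ∂(F m i) ≤ K) :
    Tendsto (fun x : Σ m, Ω m => (∑ k, g x.1 (Y x.1 i k x.2)) / (n x.1 i : ℝ)) (inProb P) (𝓝 c) := by
  refine tendsto_average_inProb (X := fun m k ω => g m (Y m i k ω)) (c := c) (K := K) (hn i)
    (fun m k => ?_) (fun m k l hkl => ?_) (fun m k => ?_) (fun m k => ?_)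
  · have hl := (hY m).hasLaw i k
    have hm : AEMeasurable (fun ω => g m (Y m i k ω)) (P m) :=
      (hg m).comp_aemeasurable hl.aemeasurable
    rw [memLp_two_iff_integrable_sq hm.aestronglyMeasurable]
    have h := hint m
    rw [← hl.map_eq] at h
    exact h.comp_aemeasurable hl.aemeasurable
  · have h := (hY m).indep.indepFun (i := ⟨i, k⟩) (j := ⟨i, l⟩) (by simpa using hkl)
    exact h.comp (hg m) (hg m)
  · rw [← hmean m]
    exact ((hY m).hasLaw i k).integral_comp (hg m).aestronglyMeasurable
  · refine le_trans (le_of_eq ?_) (hvar m)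
    exact ((hY m).hasLaw i k).integral_comp ((hg m).pow_const 2).aestronglyMeasurable

variable {K : ℝ}

theorem tendsto_stackedMean_sub_inProb (hn : ∀ i, Tendsto (fun m => n m i) atTop atTop)
    (hY : ∀ m, IsRepeatedMeasuresSample (P m) (Y m) (F m) (μ m) V)
    (h4 : ∀ m i, Integrable (fun x => (∑ s, (x s - μ m ⟨i, s⟩) ^ 2) ^ 2) (F m i)) :
    Tendsto (fun x : Σ m, Ω m => stackedMean (fun i k => Y x.1 i k x.2) - μ x.1) (inProb P)
      (𝓝 0) := by
  refine tendsto_pi_nhds.2 fun ⟨i, s⟩ => ?_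
  have h := tendsto_groupAverage_inProb hn hY i (g := fun m x => x s - μ m ⟨i, s⟩)
    (fun m => by fun_prop) (c := 0) (K := V i s s) (fun m => ?_) (fun m => ?_) (fun m => ?_)
  · refine h.congr' ?_
    filter_upwards [tendsto_fst_inProb.eventually ((hn i).eventually_gt_atTop 0)] with x hx
    have hx' : (n x.1 i : ℝ) ≠ 0 := by exact_mod_cast hx.ne'
    simp only [Pi.sub_apply, stackedMean, groupMean, Finset.sum_sub_distrib, Finset.sum_const,
      Finset.card_univ, Fintype.card_fin, nsmul_eq_mul]
    field_simp
  · have := (hY m).isProbabilityMeasure i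
    simpa only [sq] using integrable_centered_mul (c := fun s => μ m ⟨i, s⟩) (h4 m i) s s
  · have := (hY m).isProbabilityMeasure i
    rw [integral_sub ((hY m).integrable i s) (integrable_const _), (hY m).mean i s]
    simp
  · rw [← (hY m).covariance i s s]
    simp only [sq, le_refl]

/-- Recentring at a deterministic `c`, later the true mean, turns the dependent residuals into an
average of independent terms minus a product of mean errors. For `n i = 1` both sides vanish, as
division by zero gives zero. -/
theorem sampleCov_apply_eq {n : Fin a → ℕ} (y : ∀ i, Fin (n i) → Fin (t i) → ℝ) {i : Fin a}
    (hn : n i ≠ 0) (c : Fin (t i) → ℝ) (s s' : Fin (t i)) :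
    sampleCov y i s s' = (n i : ℝ) / ((n i : ℝ) - 1) *
      ((∑ k, (y i k s - c s) * (y i k s' - c s')) / (n i : ℝ) -
        (groupMean y i s - c s) * (groupMean y i s' - c s')) := by
  have hn' : (n i : ℝ) ≠ 0 := by exact_mod_cast hn
  have hsum : ∀ s, ∑ k, (y i k s - c s) = n i * (groupMean y i s - c s) := by
    intro s
    simp only [groupMean, Finset.sum_sub_distrib, Finset.sum_const, Finset.card_univ,
      Fintype.card_fin, nsmul_eq_mul]
    field_simp
  have hexp : ∑ k, (y i k s - groupMean y i s) * (y i k s' - groupMean y i s') =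
      ∑ k, (y i k s - c s) * (y i k s' - c s') -
        n i * ((groupMean y i s - c s) * (groupMean y i s' - c s')) := by
    have e : ∀ k, (y i k s - groupMean y i s) * (y i k s' - groupMean y i s') =
        (y i k s - c s) * (y i k s' - c s') - (y i k s - c s) * (groupMean y i s' - c s')
          - (groupMean y i s - c s) * (y i k s' - c s')
          + (groupMean y i s - c s) * (groupMean y i s' - c s') := fun k => by ring
    simp only [e, Finset.sum_add_distrib, Finset.sum_sub_distrib, ← Finset.sum_mul,
      ← Finset.mul_sum, hsum]
    simp only [Finset.sum_const, Finset.card_univ, Fintype.card_fin, nsmul_eq_mul]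
    ring
  simp only [sampleCov, Matrix.smul_apply, Matrix.sum_apply, Matrix.vecMulVec_apply, Pi.sub_apply,
    smul_eq_mul]
  rw [hexp]
  field_simp

/-- Consistency of the sample covariance matrices. -/
theorem tendsto_sampleCov_inProb (hn : ∀ i, Tendsto (fun m => n m i) atTop atTop)
    (hY : ∀ m, IsRepeatedMeasuresSample (P m) (Y m) (F m) (μ m) V)
    (h4 : ∀ m i, Integrable (fun x => (∑ s, (x s - μ m ⟨i, s⟩) ^ 2) ^ 2) (F m i))
    (hK : ∀ m i, ∫ x, (∑ s, (x s - μ m ⟨i, s⟩) ^ 2) ^ 2 ∂(F m i) ≤ K) (i : Fin a) :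
    Tendsto (fun x : Σ m, Ω m => sampleCov (fun i k => Y x.1 i k x.2) i) (inProb P)
      (𝓝 (V i)) := by
  refine tendsto_pi_nhds.2 fun s => tendsto_pi_nhds.2 fun s' => ?_
  have hmean := tendsto_pi_nhds.1 (tendsto_stackedMean_sub_inProb hn hY h4)
  -- The law of large numbers needs second moments of these products, and the fourth moment bound
  -- `K` dominates them.
  have hprod := tendsto_groupAverage_inProb hn hY i
    (g := fun m x => (x s - μ m ⟨i, s⟩) * (x s' - μ m ⟨i, s'⟩))
    (fun m => by fun_prop) (c := V i s s') (K := K) (fun m => ?_)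
    (fun m => (hY m).covariance i s s') (fun m => ?_)
  · have hratio : Tendsto (fun x : Σ m, Ω m => (n x.1 i : ℝ) / ((n x.1 i : ℝ) - 1)) (inProb P)
        (𝓝 1) := by
      have h1 : Tendsto (fun k : ℕ => (k : ℝ) / ((k : ℝ) - 1)) atTop (𝓝 1) := by
        simpa [sub_eq_add_neg] using tendsto_natCast_div_add_atTop (𝕜 := ℝ) (-1 : ℝ)
      exact h1.comp ((hn i).comp tendsto_fst_inProb)
    have h := hratio.mul (hprod.sub ((hmean ⟨i, s⟩).mul (hmean ⟨i, s'⟩)))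
    simp only [Pi.zero_apply, mul_zero, sub_zero, one_mul] at h
    refine h.congr' ?_
    filter_upwards [tendsto_fst_inProb.eventually ((hn i).eventually_gt_atTop 0)] with x hx
    exact (sampleCov_apply_eq (fun i k => Y x.1 i k x.2) hx.ne' (fun s => μ x.1 ⟨i, s⟩) s s').symm
  · have := (hY m).isProbabilityMeasure i
    refine (h4 m i).mono' (by fun_prop) (ae_of_all _ fun x => ?_)
    rw [Real.norm_of_nonneg (sq_nonneg _)]
    exact sq_mul_sq_le_sq_sum_sq (fun j => x j - μ m ⟨i, j⟩) s s'
  · refine le_trans (integral_mono_of_nonneg (ae_of_all _ fun x => sq_nonneg _) (h4 m i)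
      (ae_of_all _ fun x => ?_)) (hK m i)
    exact sq_mul_sq_le_sq_sum_sq (fun j => x j - μ m ⟨i, j⟩) s s'

theorem tendsto_totalSize_div {κ : Fin a → ℝ} (hκ : ∀ i, 0 < κ i)
    (hnκ : ∀ i, Tendsto (fun m => (n m i : ℝ) / (totalSize (n m) : ℝ)) atTop (𝓝 (κ i)))
    (i : Fin a) :
    Tendsto (fun m => (totalSize (n m) : ℝ) * (n m i : ℝ)⁻¹) atTop (𝓝 (κ i)⁻¹) := by
  refine ((hnκ i).inv₀ (hκ i).ne').congr fun m => ?_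
  rw [inv_div, div_eq_mul_inv]

/-- Consistency of the covariance estimator. -/
theorem tendsto_covEstimator_inProb (hn : ∀ i, Tendsto (fun m => n m i) atTop atTop)
    {κ : Fin a → ℝ} (hκ : ∀ i, 0 < κ i)
    (hnκ : ∀ i, Tendsto (fun m => (n m i : ℝ) / (totalSize (n m) : ℝ)) atTop (𝓝 (κ i)))
    (hY : ∀ m, IsRepeatedMeasuresSample (P m) (Y m) (F m) (μ m) V)
    (h4 : ∀ m i, Integrable (fun x => (∑ s, (x s - μ m ⟨i, s⟩) ^ 2) ^ 2) (F m i))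
    (hK : ∀ m i, ∫ x, (∑ s, (x s - μ m ⟨i, s⟩) ^ 2) ^ 2 ∂(F m i) ≤ K) :
    Tendsto (fun x : Σ m, Ω m => covEstimator (fun i k => Y x.1 i k x.2)) (inProb P)
      (𝓝 (limitCov κ V)) := by
  have hb : Tendsto (fun (x : Σ m, Ω m) (i : Fin a) =>
      ((totalSize (n x.1) : ℝ) * (n x.1 i : ℝ)⁻¹) • sampleCov (fun i k => Y x.1 i k x.2) i)
      (inProb P) (𝓝 fun i => (κ i)⁻¹ • V i) :=
    tendsto_pi_nhds.2 fun i => ((tendsto_totalSize_div hκ hnκ i).comp tendsto_fst_inProb).smul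
      (tendsto_sampleCov_inProb hn hY h4 hK i)
  have hc : Continuous fun M : (i : Fin a) → Matrix (Fin (t i)) (Fin (t i)) ℝ =>
      Matrix.blockDiagonal' M := Continuous.matrix_blockDiagonal' continuous_id
  refine ((hc.tendsto _).comp hb).congr fun x => ?_
  simp only [Function.comp_apply, covEstimator]
  rw [← Matrix.blockDiagonal'_smul]
  congr 1
  funext i
  simp [mul_smul]

end LawOfLargeNumbers

/-! ### Measurability of the Wald-type statistic -/

section Measurability

variable {a : ℕ} {t : Fin a → ℕ} {n : Fin a → ℕ} {r : ℕ}

theorem measurable_groupMean_apply (i : Fin a) (s : Fin (t i)) :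
    Measurable fun y : ∀ i, Fin (n i) → Fin (t i) → ℝ => groupMean y i s := by
  unfold groupMean
  fun_prop

theorem measurable_stackedMean :
    Measurable (stackedMean : (∀ i, Fin (n i) → Fin (t i) → ℝ) → _) :=
  measurable_pi_iff.2 fun p => measurable_groupMean_apply p.1 p.2

theorem measurable_sampleCov_apply (i : Fin a) (s s' : Fin (t i)) :
    Measurable fun y : ∀ i, Fin (n i) → Fin (t i) → ℝ => sampleCov y i s s' := by
  simp only [sampleCov, Matrix.smul_apply, Matrix.sum_apply, Matrix.vecMulVec_apply, Pi.sub_apply,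
    smul_eq_mul]
  have h := fun s => measurable_groupMean_apply (t := t) (n := n) i s
  have h1 := h s
  have h2 := h s'
  fun_prop

theorem measurable_covEstimator_apply (p q : (i : Fin a) × Fin (t i)) :
    Measurable fun y : ∀ i, Fin (n i) → Fin (t i) → ℝ => covEstimator y p q := by
  simp only [covEstimator, Matrix.smul_apply, Matrix.blockDiagonal'_apply, smul_eq_mul]
  refine Measurable.const_mul ?_ _
  split_ifs with h
  · exact (measurable_sampleCov_apply p.1 p.2 _).const_mul _
  · exact measurable_const

variable (H : Matrix (Fin r) ((i : Fin a) × Fin (t i)) ℝ)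

theorem measurable_moorePenrose_covEstimator_apply (j l : Fin r) :
    Measurable fun y : ∀ i, Fin (n i) → Fin (t i) → ℝ =>
      moorePenrose (H * covEstimator y * Hᵀ) j l := by
  have h : Measurable fun y : ∀ i, Fin (n i) → Fin (t i) → ℝ =>
      Matrix.of.symm (H * covEstimator y * Hᵀ) := by
    refine measurable_pi_iff.2 fun j => measurable_pi_iff.2 fun l => ?_
    simp only [Matrix.of_symm_apply, Matrix.mul_apply]
    have := measurable_covEstimator_apply (t := t) (n := n)
    fun_prop
  exact (measurable_pi_apply l).comp ((measurable_pi_apply j).comp (measurable_moorePenrose.comp h))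

theorem measurable_waldStat :
    Measurable fun y : ∀ i, Fin (n i) → Fin (t i) → ℝ => waldStat H y := by
  simp only [waldStat, dotProduct, Matrix.mulVec]
  have h1 := measurable_moorePenrose_covEstimator_apply (n := n) H
  have h2 := fun p : (i : Fin a) × Fin (t i) =>
    (measurable_pi_apply p).comp (measurable_stackedMean (t := t) (n := n))
  simp only [Function.comp_def] at h2
  fun_prop

end Measurability

/-! ### The statistic and the noncentrality parameter in whitened coordinates -/

section Decomposition

variable {a : ℕ} {t : Fin a → ℕ} {n : Fin a → ℕ} {r f : ℕ}

theorem dotProduct_mulVec_mulVec {T : Type*} [Fintype T] (B : Matrix T (Fin f) ℝ)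
    (G : Matrix T T ℝ) (z : Fin f → ℝ) : (B *ᵥ z) ⬝ᵥ (G *ᵥ (B *ᵥ z)) = z ⬝ᵥ ((Bᵀ * G * B) *ᵥ z) := by
  rw [← Matrix.mulVec_mulVec, ← Matrix.mulVec_mulVec, Matrix.mulVec_transpose,
    dotProduct_comm z, ← Matrix.dotProduct_mulVec, dotProduct_comm]

theorem dotProduct_mulVec_mulVec_transpose {T : Type*} [Fintype T] (C : Matrix (Fin f) T ℝ)
    (S : Matrix T T ℝ) (z : Fin f → ℝ) :
    (Cᵀ *ᵥ z) ⬝ᵥ (S *ᵥ (Cᵀ *ᵥ z)) = z ⬝ᵥ ((C * S * Cᵀ) *ᵥ z) := by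
  simpa using dotProduct_mulVec_mulVec Cᵀ S z

/-- Since `H Ȳ = B (C Ȳ)`, both outer factors `B` can be absorbed into the middle matrix. This is
pure algebra, valid even for a singular covariance estimate. -/
theorem waldStat_eq_of_factorization {H : Matrix (Fin r) ((i : Fin a) × Fin (t i)) ℝ}
    {B : Matrix (Fin r) (Fin f) ℝ} {C : Matrix (Fin f) ((i : Fin a) × Fin (t i)) ℝ}
    (hBC : B * C = H) (y : ∀ i, Fin (n i) → Fin (t i) → ℝ) :
    waldStat H y = (totalSize n : ℝ) * ((C *ᵥ stackedMean y) ⬝ᵥ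
      ((Bᵀ * moorePenrose (H * covEstimator y * Hᵀ) * B) *ᵥ (C *ᵥ stackedMean y))) := by
  rw [waldStat, ← dotProduct_mulVec_mulVec, Matrix.mulVec_mulVec _ B C, hBC]

/-- Whitening turns `H * S * Hᵀ` into `B * Bᵀ`, whose Moore-Penrose inverse sandwiched between `Bᵀ`
and `B` is the identity. -/
theorem noncentrality_eq_of_factorization {H : Matrix (Fin r) ((i : Fin a) × Fin (t i)) ℝ}
    {A : Matrix (Fin f) (Fin r) ℝ} {B : Matrix (Fin r) (Fin f) ℝ}
    {C : Matrix (Fin f) ((i : Fin a) × Fin (t i)) ℝ}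
    {S : Matrix ((i : Fin a) × Fin (t i)) ((i : Fin a) × Fin (t i)) ℝ}
    (hAB : A * B = 1) (hBC : B * C = H) (hC : C * S * Cᵀ = 1)
    (ν : ((i : Fin a) × Fin (t i)) → ℝ) :
    noncentrality H S ν = (C *ᵥ ν) ⬝ᵥ (C *ᵥ ν) := by
  have h : H * S * Hᵀ = B * (1 : Matrix (Fin f) (Fin f) ℝ) * Bᵀ := by
    rw [← hC, ← hBC, Matrix.transpose_mul]
    simp only [Matrix.mul_assoc]
  have hν : H *ᵥ ν = B *ᵥ (C *ᵥ ν) := by rw [Matrix.mulVec_mulVec, hBC]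
  rw [noncentrality, hν, dotProduct_mulVec_mulVec, h, transpose_mul_moorePenrose_mul hAB (by simp)]
  simp

end Decomposition

/-! ### Central limit theorem for the group means -/

section CentralLimitTheorem

variable {a : ℕ} {t : Fin a → ℕ} {V : ∀ i, Matrix (Fin (t i)) (Fin (t i)) ℝ}

theorem IsRepeatedMeasuresSample.aemeasurable {n : Fin a → ℕ} {Ω : Type*} [MeasurableSpace Ω]
    {P : Measure Ω} {Y : ∀ i, Fin (n i) → Ω → Fin (t i) → ℝ} {F : ∀ i, Measure (Fin (t i) → ℝ)}
    {μ : ((i : Fin a) × Fin (t i)) → ℝ} (hY : IsRepeatedMeasuresSample P Y F μ V) :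
    AEMeasurable (fun ω i k => Y i k ω) P :=
  aemeasurable_pi_iff.2 fun i => aemeasurable_pi_iff.2 fun k => (hY.hasLaw i k).aemeasurable

/-- The characteristic function of a linear combination of the centred group means. -/
theorem charFun_map_dotProduct_stackedMean {n : Fin a → ℕ} {Ω : Type*} [MeasurableSpace Ω]
    {P : Measure Ω} {Y : ∀ i, Fin (n i) → Ω → Fin (t i) → ℝ} {F : ∀ i, Measure (Fin (t i) → ℝ)}
    {μ : ((i : Fin a) × Fin (t i)) → ℝ} (hY : IsRepeatedMeasuresSample P Y F μ V)
    (hn : ∀ i, n i ≠ 0) (u : ((i : Fin a) × Fin (t i)) → ℝ) (q : ℝ) :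
    charFun (P.map fun ω => q * (u ⬝ᵥ (stackedMean (fun i k => Y i k ω) - μ))) 1 =
      ∏ i, charFun ((F i).map fun x => (fun s => u ⟨i, s⟩) ⬝ᵥ (x - fun s => μ ⟨i, s⟩))
        (q / (n i : ℝ)) ^ n i := by
  let ξ : ∀ i, (Fin (t i) → ℝ) → ℝ := fun i x => (fun s => u ⟨i, s⟩) ⬝ᵥ (x - fun s => μ ⟨i, s⟩)
  have hξ : ∀ i, Measurable (ξ i) := fun i => by
    simp only [ξ, dotProduct, Pi.sub_apply]; fun_prop
  -- The linear combination is a sum over all subjects of independent centred terms, so its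
  -- characteristic function factorises. Nonempty groups are needed to move the mean inside the
  -- average.
  have hsum : (fun ω => q * (u ⬝ᵥ (stackedMean (fun i k => Y i k ω) - μ))) =
      fun ω => ∑ p : (i : Fin a) × Fin (n i), q / (n p.1 : ℝ) * ξ p.1 (Y p.1 p.2 ω) := by
    funext ω
    simp only [dotProduct, Fintype.sum_sigma, Finset.mul_sum, Pi.sub_apply, ξ]
    refine Finset.sum_congr rfl fun i _ => ?_
    refine Eq.trans (Finset.sum_congr rfl fun s _ => ?_) Finset.sum_comm
    have hni : (n i : ℝ) ≠ 0 := by exact_mod_cast hn i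
    rw [← Finset.mul_sum, ← Finset.mul_sum, Finset.sum_sub_distrib]
    simp only [stackedMean, groupMean, Finset.sum_const, Finset.card_univ, Fintype.card_fin,
      nsmul_eq_mul]
    field_simp
  have hYm : ∀ p : (i : Fin a) × Fin (n i), AEMeasurable (fun ω => ξ p.1 (Y p.1 p.2 ω)) P :=
    fun p => (hξ p.1).comp_aemeasurable (hY.hasLaw p.1 p.2).aemeasurable
  have hind : iIndepFun (fun (p : (i : Fin a) × Fin (n i)) ω =>
      q / (n p.1 : ℝ) * ξ p.1 (Y p.1 p.2 ω)) P :=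
    hY.indep.comp (fun p x => q / (n p.1 : ℝ) * ξ p.1 x) fun p => (hξ p.1).const_mul _
  rw [hsum, hind.charFun_map_fun_sum_eq_prod fun p => (hYm p).const_mul _, Finset.prod_apply,
    Fintype.prod_sigma]
  refine Finset.prod_congr rfl fun i _ => ?_
  have hterm : ∀ k : Fin (n i), charFun (P.map fun ω => q / (n i : ℝ) * ξ i (Y i k ω)) 1 =
      charFun ((F i).map (ξ i)) (q / (n i : ℝ)) := fun k => by
    rw [charFun_map_mul_comp (hYm ⟨i, k⟩), mul_one, ← (hY.hasLaw i k).map_eq,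
      AEMeasurable.map_map_of_aemeasurable (hξ i).aemeasurable (hY.hasLaw i k).aemeasurable]
    rfl
  simp only [hterm]
  simp [ξ]

variable {n : ℕ → Fin a → ℕ} {Ω : ℕ → Type*} [∀ m, MeasurableSpace (Ω m)]
  {P : ∀ m, Measure (Ω m)}
  {Y : ∀ m i, Fin (n m i) → Ω m → Fin (t i) → ℝ} {F : ℕ → ∀ i, Measure (Fin (t i) → ℝ)}
  {μ : ℕ → ((i : Fin a) × Fin (t i)) → ℝ} {κ : Fin a → ℝ} {K : ℝ} {f : ℕ}

theorem dotProduct_limitCov_mulVec (u : ((i : Fin a) × Fin (t i)) → ℝ) :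
    u ⬝ᵥ (limitCov κ V *ᵥ u) =
      ∑ i, (κ i)⁻¹ * ((fun s => u ⟨i, s⟩) ⬝ᵥ (V i *ᵥ fun s => u ⟨i, s⟩)) := by
  simp only [dotProduct, Matrix.mulVec, Fintype.sum_sigma, limitCov]
  refine Finset.sum_congr rfl fun i _ => ?_
  rw [Finset.mul_sum]
  refine Finset.sum_congr rfl fun s _ => ?_
  rw [Finset.sum_eq_single i]
  · simp only [Matrix.blockDiagonal'_apply_eq, Matrix.smul_apply, smul_eq_mul, mul_assoc]
    rw [← Finset.mul_sum]
    ring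
  · intro j _ hj
    exact Finset.sum_eq_zero fun s' _ => by
      rw [Matrix.blockDiagonal'_apply_ne _ _ _ hj.symm, zero_mul]
  · simp

/-- Group `i` contributes a power `n i` at frequency `s = √N / n i`. Here `n i * s ^ 2 = N / n i → 1
/ κ i`, the weight of `V i` in the limit covariance, while `s ^ 2 = (N / n i) / n i → 0`. -/
theorem tendsto_charFun_dotProduct_stackedMean (hn : ∀ i, Tendsto (fun m => n m i) atTop atTop)
    (hκ : ∀ i, 0 < κ i)
    (hnκ : ∀ i, Tendsto (fun m => (n m i : ℝ) / (totalSize (n m) : ℝ)) atTop (𝓝 (κ i)))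
    (hY : ∀ m, IsRepeatedMeasuresSample (P m) (Y m) (F m) (μ m) V)
    (h4 : ∀ m i, Integrable (fun x => (∑ s, (x s - μ m ⟨i, s⟩) ^ 2) ^ 2) (F m i))
    (hK : ∀ m i, ∫ x, (∑ s, (x s - μ m ⟨i, s⟩) ^ 2) ^ 2 ∂(F m i) ≤ K)
    (u : ((i : Fin a) × Fin (t i)) → ℝ) :
    Tendsto (fun m => charFun ((P m).map fun ω => √(totalSize (n m) : ℝ) *
      (u ⬝ᵥ (stackedMean (fun i k => Y m i k ω) - μ m))) 1) atTop
      (𝓝 (Complex.exp (-(u ⬝ᵥ (limitCov κ V *ᵥ u) / 2 : ℝ)))) := by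
  have hmeas : ∀ m i, Measurable fun x : Fin (t i) → ℝ =>
      (fun s => u ⟨i, s⟩) ⬝ᵥ (x - fun s => μ m ⟨i, s⟩) := fun m i => by
    simp only [dotProduct, Pi.sub_apply]; fun_prop
  have hi : ∀ i, Tendsto (fun m => charFun ((F m i).map fun x =>
      (fun s => u ⟨i, s⟩) ⬝ᵥ (x - fun s => μ m ⟨i, s⟩))
        (√(totalSize (n m) : ℝ) / (n m i : ℝ)) ^ n m i) atTop
      (𝓝 (Complex.exp (-((κ i)⁻¹ * ((fun s => u ⟨i, s⟩) ⬝ᵥ (V i *ᵥ fun s => u ⟨i, s⟩)) / 2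
        : ℝ)))) := by
    intro i
    have hF : ∀ m, IsProbabilityMeasure (F m i) := fun m => (hY m).isProbabilityMeasure i
    have hprob : ∀ m, IsProbabilityMeasure ((F m i).map fun x =>
        (fun s => u ⟨i, s⟩) ⬝ᵥ (x - fun s => μ m ⟨i, s⟩)) := fun m =>
      Measure.isProbabilityMeasure_map (hmeas m i).aemeasurable
    have hratio := tendsto_totalSize_div hκ hnκ i
    have hinv : Tendsto (fun m => ((n m i : ℝ))⁻¹) atTop (𝓝 0) :=
      tendsto_inv_atTop_zero.comp (tendsto_natCast_atTop_atTop.comp (hn i))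
    refine tendsto_charFun_pow (K := (∑ s, u ⟨i, s⟩ ^ 2) ^ 2 * K) (fun m => ?_) (fun m => ?_)
      (fun m => ?_) (fun m => ?_) ?_ ?_
    · rw [integrable_map_measure (by fun_prop) (hmeas m i).aemeasurable]
      exact integrable_dotProduct_pow_four (c := fun s => μ m ⟨i, s⟩) (h4 m i) _
    · rw [integral_map (hmeas m i).aemeasurable (by fun_prop)]
      exact integral_dotProduct_centered (c := fun s => μ m ⟨i, s⟩) ((hY m).integrable i)
        ((hY m).mean i) _
    · rw [integral_map (hmeas m i).aemeasurable (by fun_prop)]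
      exact integral_dotProduct_centered_sq (c := fun s => μ m ⟨i, s⟩) (h4 m i)
        ((hY m).covariance i) _
    · rw [integral_map (hmeas m i).aemeasurable (by fun_prop)]
      exact integral_dotProduct_pow_four_le (c := fun s => μ m ⟨i, s⟩) (h4 m i) (hK m i) _
    · have h := (Real.continuous_sqrt.tendsto _).comp (hratio.mul hinv)
      rw [mul_zero, Real.sqrt_zero] at h
      refine h.congr fun m => ?_
      have e : (totalSize (n m) : ℝ) * (n m i : ℝ)⁻¹ * (n m i : ℝ)⁻¹ =
          (totalSize (n m) : ℝ) * ((n m i : ℝ)⁻¹) ^ 2 := by ring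
      rw [Function.comp_apply, e, Real.sqrt_mul (Nat.cast_nonneg _), Real.sqrt_sq (by positivity),
        div_eq_mul_inv]
    · refine hratio.congr' ?_
      filter_upwards [(hn i).eventually_gt_atTop 0] with m hm
      have hm' : (n m i : ℝ) ≠ 0 := by exact_mod_cast hm.ne'
      rw [div_pow, Real.sq_sqrt (Nat.cast_nonneg _)]
      field_simp
  have hprod := tendsto_finsetProd Finset.univ fun i _ => hi i
  have hlim : ∏ i, Complex.exp (-((κ i)⁻¹ * ((fun s => u ⟨i, s⟩) ⬝ᵥ (V i *ᵥ fun s => u ⟨i, s⟩)) / 2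
      : ℝ)) = Complex.exp (-(u ⬝ᵥ (limitCov κ V *ᵥ u) / 2 : ℝ)) := by
    rw [← Complex.exp_sum, dotProduct_limitCov_mulVec]
    congr 1
    push_cast
    rw [Finset.sum_neg_distrib, Finset.sum_div]
  rw [hlim] at hprod
  refine hprod.congr' ?_
  filter_upwards [eventually_all.2 fun i => (hn i).eventually_gt_atTop 0] with m hm
  exact (charFun_map_dotProduct_stackedMean (hY m) (fun i => (hm i).ne') u _).symm

/-- Central limit theorem for the scaled and whitened vector of group means. -/
theorem tendstoInDistribution_sqrt_smul_stackedMean [∀ m, IsProbabilityMeasure (P m)]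
    (hn : ∀ i, Tendsto (fun m => n m i) atTop atTop) (hκ : ∀ i, 0 < κ i)
    (hnκ : ∀ i, Tendsto (fun m => (n m i : ℝ) / (totalSize (n m) : ℝ)) atTop (𝓝 (κ i)))
    (hY : ∀ m, IsRepeatedMeasuresSample (P m) (Y m) (F m) (μ m) V)
    (h4 : ∀ m i, Integrable (fun x => (∑ s, (x s - μ m ⟨i, s⟩) ^ 2) ^ 2) (F m i))
    (hK : ∀ m i, ∫ x, (∑ s, (x s - μ m ⟨i, s⟩) ^ 2) ^ 2 ∂(F m i) ≤ K)
    {C : Matrix (Fin f) ((i : Fin a) × Fin (t i)) ℝ} (hC : C * limitCov κ V * Cᵀ = 1)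
    {η : EuclideanSpace ℝ (Fin f)}
    (hη : ∀ᶠ m in atTop, √(totalSize (n m) : ℝ) • (C *ᵥ μ m) = η.ofLp) :
    TendstoInDistribution (fun m ω => WithLp.toLp 2 (√(totalSize (n m) : ℝ) •
      (C *ᵥ stackedMean (fun i k => Y m i k ω)))) atTop (fun z => η + z) P
      (stdGaussian (EuclideanSpace ℝ (Fin f))) where
  forall_aemeasurable m := by
    have h := measurable_stackedMean.comp_aemeasurable (hY m).aemeasurable
    have hg : Measurable fun x : ((i : Fin a) × Fin (t i)) → ℝ =>
        WithLp.toLp 2 (√(totalSize (n m) : ℝ) • (C *ᵥ x)) := by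
      have : Continuous fun x : ((i : Fin a) × Fin (t i)) → ℝ =>
        WithLp.toLp 2 (√(totalSize (n m) : ℝ) • (C *ᵥ x)) := by fun_prop
      exact this.measurable
    exact hg.comp_aemeasurable h
  tendsto := by
    -- Lévy's continuity theorem with the Cramér-Wold device: testing `C Ȳ` against `τ` tests `Ȳ`
    -- against `Cᵀ τ`, whose limiting variance is `‖τ‖ ^ 2` by whitening. The mean contributes the
    -- phase `⟨η, τ⟩`.
    refine ProbabilityMeasure.tendsto_iff_tendsto_charFun.2 fun τ => ?_
    let u : ((i : Fin a) × Fin (t i)) → ℝ := Cᵀ *ᵥ τ.ofLp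
    have hlim := (tendsto_charFun_dotProduct_stackedMean hn hκ hnκ hY h4 hK u).mul_const
      (Complex.exp (inner ℝ η τ * Complex.I))
    have hu : u ⬝ᵥ (limitCov κ V *ᵥ u) = ‖τ‖ ^ 2 := by
      have h := dotProduct_mulVec_mulVec_transpose C (limitCov κ V) τ.ofLp
      rw [hC, Matrix.one_mulVec] at h
      rw [h, EuclideanSpace.real_norm_sq_eq]
      simp [dotProduct, sq]
    rw [hu] at hlim
    simp only [ProbabilityMeasure.coe_mk]
    rw [show (fun z => η + z) = (η + ·) from rfl, charFun_map_const_add, charFun_stdGaussian]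
    have e : Complex.exp (-(‖τ‖ ^ 2 / 2 : ℝ)) = Complex.exp (-(‖τ‖ : ℂ) ^ 2 / 2) := by
      congr 1; push_cast; ring
    rw [← e]
    refine hlim.congr' ?_
    filter_upwards [hη] with m hm
    have hmeas : AEMeasurable (fun ω => stackedMean (fun i k => Y m i k ω)) (P m) :=
      measurable_stackedMean.comp_aemeasurable (hY m).aemeasurable
    have hc1 : Continuous fun x : ((i : Fin a) × Fin (t i)) → ℝ =>
        √(totalSize (n m) : ℝ) * (u ⬝ᵥ (x - μ m)) := by
      simp only [dotProduct]; fun_prop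
    have hc2 : Continuous fun x : ((i : Fin a) × Fin (t i)) → ℝ =>
        WithLp.toLp 2 (√(totalSize (n m) : ℝ) • (C *ᵥ x)) := by fun_prop
    have hm1 : AEMeasurable (fun ω => √(totalSize (n m) : ℝ) *
        (u ⬝ᵥ (stackedMean (fun i k => Y m i k ω) - μ m))) (P m) :=
      hc1.measurable.comp_aemeasurable hmeas
    have hm2 : AEMeasurable (fun ω => WithLp.toLp 2 (√(totalSize (n m) : ℝ) •
        (C *ᵥ stackedMean (fun i k => Y m i k ω)))) (P m) :=
      hc2.measurable.comp_aemeasurable hmeas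
    rw [charFun_apply, charFun_apply, integral_map hm1 (by fun_prop),
      integral_map hm2 (by fun_prop), ← integral_mul_const]
    refine integral_congr_ae (ae_of_all _ fun ω => ?_)
    simp only [← Complex.exp_add]
    congr 1
    rw [← add_mul, ← Complex.ofReal_add]
    congr 2
    have hin : ∀ x : Fin f → ℝ, inner ℝ (WithLp.toLp 2 x) τ = x ⬝ᵥ τ.ofLp := fun x => by
      simp [PiLp.inner_apply, dotProduct, mul_comm]
    have hin' : inner ℝ η τ = η.ofLp ⬝ᵥ τ.ofLp := hin η.ofLp
    have hdot : ∀ x, u ⬝ᵥ x = (C *ᵥ x) ⬝ᵥ τ.ofLp := fun x => by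
      simp only [u]
      rw [Matrix.mulVec_transpose, ← Matrix.dotProduct_mulVec, dotProduct_comm]
    rw [hin', hin, ← hm, hdot, Matrix.mulVec_sub, sub_dotProduct, smul_dotProduct, smul_dotProduct]
    simp
    ring

end CentralLimitTheorem

/-! ### Limit law and power of the Wald-type test -/

section WaldType

theorem tendsto_matrix_inv {ι k : Type*} [Fintype k] [DecidableEq k] {l : Filter ι}
    {M : ι → Matrix k k ℝ} {M₀ : Matrix k k ℝ} (hM₀ : IsUnit M₀.det) (hM : Tendsto M l (𝓝 M₀)) :
    Tendsto (fun x => (M x)⁻¹) l (𝓝 M₀⁻¹) := by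
  simp only [Matrix.inv_def, Ring.inverse_eq_inv']
  have hdet : Continuous fun A : Matrix k k ℝ => A.det := continuous_id.matrix_det
  have hadj : Continuous fun A : Matrix k k ℝ => A.adjugate := continuous_id.matrix_adjugate
  exact (((hdet.tendsto _).comp hM).inv₀ hM₀.ne_zero).smul ((hadj.tendsto _).comp hM)

variable {a r : ℕ} {t : Fin a → ℕ} {V : ∀ i, Matrix (Fin (t i)) (Fin (t i)) ℝ} {κ : Fin a → ℝ}

theorem posDef_limitCov (hV : ∀ i, (V i).PosDef) (hκ : ∀ i, 0 < κ i) : (limitCov κ V).PosDef := by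
  refine .of_dotProduct_mulVec_pos ?_ fun u hu => ?_
  · rw [Matrix.IsHermitian, limitCov, Matrix.blockDiagonal'_conjTranspose]
    congr 1
    funext i
    rw [Matrix.conjTranspose_smul, (hV i).1.eq, star_trivial]
  · rw [star_trivial, dotProduct_limitCov_mulVec]
    have hnn : ∀ i, 0 ≤ (κ i)⁻¹ * ((fun s => u ⟨i, s⟩) ⬝ᵥ (V i *ᵥ fun s => u ⟨i, s⟩)) := fun i =>
      mul_nonneg (inv_nonneg.2 (hκ i).le) (by
        simpa using (hV i).posSemidef.dotProduct_mulVec_nonneg fun s => u ⟨i, s⟩)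
    obtain ⟨⟨i, s⟩, his⟩ := Function.ne_iff.1 hu
    refine Finset.sum_pos' (fun i _ => hnn i) ⟨i, Finset.mem_univ i, ?_⟩
    refine mul_pos (inv_pos.2 (hκ i)) ?_
    have := (hV i).dotProduct_mulVec_pos (x := fun s => u ⟨i, s⟩)
      (Function.ne_iff.2 ⟨s, by simpa using his⟩)
    simpa using this

variable {n : ℕ → Fin a → ℕ} {Ω : ℕ → Type*} [∀ m, MeasurableSpace (Ω m)]
  {P : ∀ m, Measure (Ω m)}
  {Y : ∀ m i, Fin (n m i) → Ω m → Fin (t i) → ℝ} {F : ℕ → ∀ i, Measure (Fin (t i) → ℝ)}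
  {μ : ℕ → ((i : Fin a) × Fin (t i)) → ℝ} {K : ℝ} {f : ℕ}
  {H : Matrix (Fin r) ((i : Fin a) × Fin (t i)) ℝ} {A : Matrix (Fin f) (Fin r) ℝ}
  {B : Matrix (Fin r) (Fin f) ℝ} {C : Matrix (Fin f) ((i : Fin a) × Fin (t i)) ℝ}

/-- In whitened coordinates the Moore-Penrose inverse of the estimated covariance matrix is
consistent. -/
theorem tendsto_moorePenrose_covEstimator_inProb
    (hS : Tendsto (fun x : Σ m, Ω m => covEstimator (fun i k => Y x.1 i k x.2)) (inProb P)
      (𝓝 (limitCov κ V)))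
    (hAB : A * B = 1) (hBC : B * C = H) (hC : C * limitCov κ V * Cᵀ = 1) :
    Tendsto (fun x : Σ m, Ω m =>
      Bᵀ * moorePenrose (H * covEstimator (fun i k => Y x.1 i k x.2) * Hᵀ) * B) (inProb P)
      (𝓝 1) := by
  have hc : Continuous fun S : Matrix ((i : Fin a) × Fin (t i)) ((i : Fin a) × Fin (t i)) ℝ =>
      C * S * Cᵀ := by fun_prop
  have hM := (hc.tendsto _).comp hS
  rw [hC] at hM
  have hdet : Tendsto (fun x : Σ m, Ω m =>
      (C * covEstimator (fun i k => Y x.1 i k x.2) * Cᵀ).det) (inProb P) (𝓝 1) := by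
    have hd : Continuous fun A : Matrix (Fin f) (Fin f) ℝ => A.det := continuous_id.matrix_det
    have := (hd.tendsto _).comp hM
    rwa [Matrix.det_one] at this
  have hinv := tendsto_matrix_inv (by simp) hM
  rw [inv_one] at hinv
  refine hinv.congr' ?_
  -- Invertibility of `C Σ̂ Cᵀ` may fail for some samples, but only with probability tending to
  -- zero; elsewhere the sandwiched Moore-Penrose inverse is an ordinary inverse.
  filter_upwards [hdet.eventually_ne one_ne_zero] with x hx
  rw [← hBC, Matrix.transpose_mul]
  have e : B * C * covEstimator (fun i k => Y x.1 i k x.2) * (Cᵀ * Bᵀ) =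
      B * (C * covEstimator (fun i k => Y x.1 i k x.2) * Cᵀ) * Bᵀ := by
    simp only [Matrix.mul_assoc]
  rw [e, transpose_mul_moorePenrose_mul hAB (isUnit_iff_ne_zero.2 hx)]
  rfl

theorem aemeasurable_waldStat (H : Matrix (Fin r) ((i : Fin a) × Fin (t i)) ℝ)
    (hY : ∀ m, IsRepeatedMeasuresSample (P m) (Y m) (F m) (μ m) V) (m : ℕ) :
    AEMeasurable (fun ω => waldStat H (fun i k => Y m i k ω)) (P m) :=
  (measurable_waldStat H).comp_aemeasurable (hY m).aemeasurable

theorem integral_waldTest (H : Matrix (Fin r) ((i : Fin a) × Fin (t i)) ℝ) (α : ℝ)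
    (hY : ∀ m, IsRepeatedMeasuresSample (P m) (Y m) (F m) (μ m) V) (m : ℕ) :
    ∫ ω, waldTest H α (fun i k => Y m i k ω) ∂(P m) =
      (P m).real {ω | criticalValue H α < waldStat H (fun i k => Y m i k ω)} := by
  have hs : NullMeasurableSet {ω | criticalValue H α < waldStat H (fun i k => Y m i k ω)} (P m) :=
    nullMeasurableSet_lt aemeasurable_const (aemeasurable_waldStat H hY m)
  have e : (fun ω => waldTest H α (fun i k => Y m i k ω)) =
      Set.indicator {ω | criticalValue H α < waldStat H (fun i k => Y m i k ω)} fun _ => 1 := by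
    funext ω
    simp only [waldTest, Set.indicator, Set.mem_ofPred_eq]
  rw [e, integral_indicator₀ hs]
  simp

variable [∀ m, IsProbabilityMeasure (P m)]

/-- Limit law of the Wald-type statistic, given the limits of the whitened vector of group means and
of the covariance estimator. -/
theorem tendstoInDistribution_waldStat
    (hY : ∀ m, IsRepeatedMeasuresSample (P m) (Y m) (F m) (μ m) V)
    (hS : Tendsto (fun x : Σ m, Ω m => covEstimator (fun i k => Y x.1 i k x.2)) (inProb P)
      (𝓝 (limitCov κ V)))
    (hAB : A * B = 1) (hBC : B * C = H) (hC : C * limitCov κ V * Cᵀ = 1)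
    {η : EuclideanSpace ℝ (Fin f)}
    (hX : TendstoInDistribution (fun m ω => WithLp.toLp 2 (√(totalSize (n m) : ℝ) •
      (C *ᵥ stackedMean (fun i k => Y m i k ω)))) atTop (fun z => η + z) P
      (stdGaussian (EuclideanSpace ℝ (Fin f)))) :
    TendstoInDistribution (fun m ω => waldStat H (fun i k => Y m i k ω)) atTop (id : ℝ → ℝ) P
      (noncentralChiSq f (‖η‖ ^ 2)) := by
  -- Slutsky's theorem is applied to this quadratic form; the two factors `√N` in the vector produce
  -- the factor `N` of the statistic.
  let g : EuclideanSpace ℝ (Fin f) × (Fin f → Fin f → ℝ) → ℝ :=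
    fun p => p.1.ofLp ⬝ᵥ (Matrix.of p.2 *ᵥ p.1.ofLp)
  have hg : Continuous g := by
    simp only [g, dotProduct, Matrix.mulVec, Matrix.of_apply]
    fun_prop
  let W : ∀ m, Ω m → Fin f → Fin f → ℝ := fun m ω => Matrix.of.symm
    (Bᵀ * moorePenrose (H * covEstimator (fun i k => Y m i k ω) * Hᵀ) * B)
  have hW : ∀ m, AEMeasurable (W m) (P m) := by
    intro m
    have h : Measurable fun y : ∀ i, Fin (n m i) → Fin (t i) → ℝ => Matrix.of.symm
        (Bᵀ * moorePenrose (H * covEstimator y * Hᵀ) * B) := by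
      refine measurable_pi_iff.2 fun j => measurable_pi_iff.2 fun l => ?_
      simp only [Matrix.of_symm_apply, Matrix.mul_apply]
      have := measurable_moorePenrose_covEstimator_apply (n := n m) H
      fun_prop
    exact h.comp_aemeasurable (hY m).aemeasurable
  have hWc : Tendsto (fun x : Σ m, Ω m => W x.1 x.2) (inProb P)
      (𝓝 (Matrix.of.symm (1 : Matrix (Fin f) (Fin f) ℝ))) :=
    tendsto_moorePenrose_covEstimator_inProb hS hAB hBC hC
  have key := tendstoInDistribution_comp_of_inProb hg hX hW hWc
  have hstat : ∀ m ω, g (WithLp.toLp 2 (√(totalSize (n m) : ℝ) •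
      (C *ᵥ stackedMean (fun i k => Y m i k ω))), W m ω) =
      waldStat H (fun i k => Y m i k ω) := by
    intro m ω
    rw [waldStat_eq_of_factorization hBC]
    simp only [g, W, Equiv.apply_symm_apply, Matrix.mulVec_smul, smul_dotProduct, dotProduct_smul,
      smul_eq_mul]
    rw [← mul_assoc, Real.mul_self_sqrt (Nat.cast_nonneg _)]
  have hlim : (fun z => g (η + z, Matrix.of.symm (1 : Matrix (Fin f) (Fin f) ℝ))) =
      fun z => ‖η + z‖ ^ 2 := by
    funext z
    simp only [g, Equiv.apply_symm_apply, Matrix.one_mulVec]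
    rw [EuclideanSpace.real_norm_sq_eq]
    simp [dotProduct, sq]
  simp only [hstat, hlim] at key
  refine ⟨key.forall_aemeasurable, aemeasurable_id, ?_⟩
  have h := key.tendsto
  have e : (⟨(noncentralChiSq f (‖η‖ ^ 2)).map id,
      Measure.isProbabilityMeasure_map aemeasurable_id⟩ : ProbabilityMeasure ℝ) =
      ⟨(stdGaussian (EuclideanSpace ℝ (Fin f))).map (fun z => ‖η + z‖ ^ 2),
        Measure.isProbabilityMeasure_map key.aemeasurable_limit⟩ := by
    refine Subtype.ext ?_
    simp only [Measure.map_id]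
    exact (map_norm_add_sq_stdGaussian η).symm
  rw [e]
  exact h

/-- Portmanteau theorem: the boundary of the half-line is the single point `c`, which the limit law
does not charge. -/
theorem tendsto_measureReal_Ioi_of_tendstoInDistribution {ρ : Measure ℝ} [IsProbabilityMeasure ρ]
    {X : ∀ m, Ω m → ℝ} (hX : TendstoInDistribution X atTop (id : ℝ → ℝ) P ρ) {c : ℝ}
    (hc : ρ {c} = 0) :
    Tendsto (fun m => (P m).real {ω | c < X m ω}) atTop (𝓝 (ρ.real (Set.Ioi c))) := by
  have h := ProbabilityMeasure.tendsto_measure_of_null_frontier_of_tendsto' hX.tendsto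
    (E := Set.Ioi c) (by simpa [frontier_Ioi] using hc)
  simp only [ProbabilityMeasure.coe_mk, Measure.map_id] at h
  have h2 := (ENNReal.tendsto_toReal (measure_ne_top _ _)).comp h
  refine h2.congr fun m => ?_
  simp only [Function.comp_apply]
  rw [Measure.map_apply_of_aemeasurable (hX.forall_aemeasurable m) measurableSet_Ioi]
  rfl

theorem waldStat_zero {n : Fin a → ℕ} (y : ∀ i, Fin (n i) → Fin (t i) → ℝ) :
    waldStat (0 : Matrix (Fin r) ((i : Fin a) × Fin (t i)) ℝ) y = 0 := by
  simp [waldStat]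

theorem waldTest_zero {n : Fin a → ℕ} {α : ℝ} (hα : α ∈ Set.Ioo (0 : ℝ) 1)
    (y : ∀ i, Fin (n i) → Fin (t i) → ℝ) :
    waldTest (0 : Matrix (Fin r) ((i : Fin a) × Fin (t i)) ℝ) α y = 0 := by
  rw [waldTest, waldStat_zero, if_neg]
  exact not_lt.2 (quantile_chiSq_nonneg _ (by linarith [hα.2]))

/-- Convergence of the power of the Wald-type test along local alternatives. -/
theorem tendsto_integral_waldTest {δ : ℝ}
    (hY : ∀ m, IsRepeatedMeasuresSample (P m) (Y m) (F m) (μ m) V)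
    (hQ : TendstoInDistribution (fun m ω => waldStat H (fun i k => Y m i k ω)) atTop
      (id : ℝ → ℝ) P (noncentralChiSq H.rank δ)) {α : ℝ} (hα : α ∈ Set.Ioo (0 : ℝ) 1) :
    Tendsto (fun m => ∫ ω, waldTest H α (fun i k => Y m i k ω) ∂(P m)) atTop
      (𝓝 ((noncentralChiSq H.rank δ).real (Set.Ioi (criticalValue H α)))) := by
  -- For rank zero the limit law is the point mass at `0`, so absence of atoms cannot be invoked.
  -- Then `H = 0`, and both the test and the limiting power are zero.
  by_cases hf : H.rank = 0
  · have hcrit : 0 ≤ criticalValue H α := quantile_chiSq_nonneg _ (by linarith [hα.2])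
    rw [hf, noncentralChiSq_zero_eq_dirac]
    obtain rfl := eq_zero_of_rank_eq_zero hf
    simp only [waldTest_zero hα, integral_zero]
    rw [measureReal_def, Measure.dirac_apply' _ measurableSet_Ioi]
    simp [hcrit]
  · simp only [integral_waldTest H α hY]
    have := nullSingletonClass_noncentralChiSq hf δ
    exact tendsto_measureReal_Ioi_of_tendstoInDistribution hQ (measure_singleton _)

theorem measureReal_chiSq_Ioi_criticalValue (hH : H ≠ 0) {α : ℝ} (hα : α ∈ Set.Ioo (0 : ℝ) 1) :
    (chiSq H.rank).real (Set.Ioi (criticalValue H α)) = α := by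
  have : NullSingletonClass (chiSq H.rank) := by
    rw [← noncentralChiSq_zero]
    exact nullSingletonClass_noncentralChiSq (fun h => hH (eq_zero_of_rank_eq_zero h)) 0
  rw [criticalValue, measureReal_Ioi_quantile ⟨by linarith [hα.2], by linarith [hα.1]⟩]
  ring

theorem tendsto_totalSize (hn : ∀ i, Tendsto (fun m => n m i) atTop atTop) (i : Fin a) :
    Tendsto (fun m => totalSize (n m)) atTop atTop :=
  tendsto_atTop_mono (fun m => Finset.single_le_sum (f := n m) (fun _ _ => zero_le)
    (Finset.mem_univ i)) (hn i)

/-- Consistency of the Wald-type test at a fixed alternative. -/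
theorem tendsto_integral_waldTest_of_fixed_alternative
    (hn : ∀ i, Tendsto (fun m => n m i) atTop atTop)
    (hY : ∀ m, IsRepeatedMeasuresSample (P m) (Y m) (F m) (μ m) V)
    (hS : Tendsto (fun x : Σ m, Ω m => covEstimator (fun i k => Y x.1 i k x.2)) (inProb P)
      (𝓝 (limitCov κ V)))
    {μ₀ : ((i : Fin a) × Fin (t i)) → ℝ} (hH : H *ᵥ μ₀ ≠ 0)
    (hmean : Tendsto (fun x : Σ m, Ω m => stackedMean (fun i k => Y x.1 i k x.2)) (inProb P) (𝓝 μ₀))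
    (hAB : A * B = 1) (hBC : B * C = H) (hC : C * limitCov κ V * Cᵀ = 1) (α : ℝ) :
    Tendsto (fun m => ∫ ω, waldTest H α (fun i k => Y m i k ω) ∂(P m)) atTop (𝓝 1) := by
  -- Some group must exist, since otherwise `H *ᵥ μ₀` would be zero; its growing size forces `N →
  -- ∞`.
  obtain ⟨i⟩ : Nonempty (Fin a) := by
    by_contra h
    rw [not_nonempty_iff] at h
    exact hH (by rw [Subsingleton.elim μ₀ 0, Matrix.mulVec_zero])
  have hW := tendsto_moorePenrose_covEstimator_inProb hS hAB hBC hC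
  have hg : Continuous fun p : (((i : Fin a) × Fin (t i)) → ℝ) × Matrix (Fin f) (Fin f) ℝ =>
      (C *ᵥ p.1) ⬝ᵥ (p.2 *ᵥ (C *ᵥ p.1)) := by
    fun_prop
  -- This is `Q_N / N`, whose limit is the squared norm of `C *ᵥ μ₀`; it is positive because `B`
  -- maps that vector to `H *ᵥ μ₀ ≠ 0`.
  have hq := (hg.tendsto (μ₀, 1)).comp (hmean.prodMk_nhds hW)
  simp only [Matrix.one_mulVec] at hq
  have hpos : 0 < (C *ᵥ μ₀) ⬝ᵥ (C *ᵥ μ₀) := by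
    have hne : C *ᵥ μ₀ ≠ 0 := fun h => hH (by
      rw [← hBC, ← Matrix.mulVec_mulVec, h, Matrix.mulVec_zero])
    simpa using dotProduct_star_self_pos_iff.2 hne
  have hN : Tendsto (fun x : Σ m, Ω m => (totalSize (n x.1) : ℝ)) (inProb P) atTop :=
    tendsto_natCast_atTop_atTop.comp ((tendsto_totalSize hn i).comp tendsto_fst_inProb)
  have hQ : Tendsto (fun x : Σ m, Ω m => waldStat H (fun i k => Y x.1 i k x.2)) (inProb P)
      atTop := by
    refine (hN.atTop_mul_pos hpos hq).congr fun x => ?_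
    rw [waldStat_eq_of_factorization hBC]
    rfl
  simp only [integral_waldTest H α hY]
  exact tendsto_measureReal_of_eventually_inProb
    (p := fun x => criticalValue H α < waldStat H (fun i k => Y x.1 i k x.2))
    (fun m => nullMeasurableSet_lt aemeasurable_const (aemeasurable_waldStat H hY m))
    (hQ.eventually_gt_atTop _)

end WaldType

end WTS

/-- Asymptotics of the Wald-type statistic in a heteroscedastic repeated measures model.  The index
`m` runs through a sequence of models with group sizes `n m i`. -/
theorem theorem2p2 {a r : ℕ} (t : Fin a → ℕ)
    (H : Matrix (Fin r) ((i : Fin a) × Fin (t i)) ℝ)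
    (V : ∀ i, Matrix (Fin (t i)) (Fin (t i)) ℝ) (hV : ∀ i, (V i).PosDef)
    (κ : Fin a → ℝ) (hκ : ∀ i, 0 < κ i)
    (n : ℕ → Fin a → ℕ) (hn : ∀ i, Tendsto (fun m => n m i) atTop atTop)
    (hnκ : ∀ i, Tendsto (fun m => (n m i : ℝ) / (WTS.totalSize (n m) : ℝ)) atTop (𝓝 (κ i)))
    {Ω : ℕ → Type*} [∀ m, MeasurableSpace (Ω m)]
    (P : ∀ m, Measure (Ω m)) [∀ m, IsProbabilityMeasure (P m)]
    (Y : ∀ m i, Fin (n m i) → Ω m → Fin (t i) → ℝ)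
    (F : ℕ → ∀ i, Measure (Fin (t i) → ℝ))
    (μ : ℕ → ((i : Fin a) × Fin (t i)) → ℝ)
    (hY : ∀ m, WTS.IsRepeatedMeasuresSample (P m) (Y m) (F m) (μ m) V)
    -- uniformly bounded fourth moments
    (h4 : ∃ C : ℝ≥0, ∀ m i,
      ∫⁻ x, ENNReal.ofReal ((∑ s, (x s - μ m ⟨i, s⟩) ^ 2) ^ 2) ∂(F m i) ≤ C) :
    -- the null hypothesis
    ((∀ m, H *ᵥ μ m = 0) →
      TendstoInDistribution (fun m ω => WTS.waldStat H (fun i k => Y m i k ω)) atTop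
        (id : ℝ → ℝ) P (WTS.chiSq H.rank) ∧
      (H ≠ 0 → ∀ α ∈ Set.Ioo (0 : ℝ) 1,
        Tendsto (fun m => ∫ ω, WTS.waldTest H α (fun i k => Y m i k ω) ∂(P m)) atTop (𝓝 α)) ∧
      (H = 0 → ∀ α ∈ Set.Ioo (0 : ℝ) 1, ∀ m,
        ∫ ω, WTS.waldTest H α (fun i k => Y m i k ω) ∂(P m) = 0)) ∧
    -- fixed alternatives
    (∀ μ₀ : ((i : Fin a) × Fin (t i)) → ℝ, H *ᵥ μ₀ ≠ 0 → (∀ m, μ m = μ₀) →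
      ∀ α ∈ Set.Ioo (0 : ℝ) 1,
        Tendsto (fun m => ∫ ω, WTS.waldTest H α (fun i k => Y m i k ω) ∂(P m)) atTop (𝓝 1)) ∧
    -- local alternatives
    (∀ ν : ((i : Fin a) × Fin (t i)) → ℝ,
      (∀ m, H *ᵥ μ m = (√(WTS.totalSize (n m) : ℝ))⁻¹ • (H *ᵥ ν)) →
      TendstoInDistribution (fun m ω => WTS.waldStat H (fun i k => Y m i k ω)) atTop
        (id : ℝ → ℝ) P
        (WTS.noncentralChiSq H.rank (WTS.noncentrality H (WTS.limitCov κ V) ν)) ∧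
      ∀ α ∈ Set.Ioo (0 : ℝ) 1,
        Tendsto (fun m => ∫ ω, WTS.waldTest H α (fun i k => Y m i k ω) ∂(P m)) atTop
          (𝓝 ((WTS.noncentralChiSq H.rank (WTS.noncentrality H (WTS.limitCov κ V) ν)).real
            (Set.Ioi (WTS.criticalValue H α))))) := by
  obtain ⟨K, hK⟩ := h4
  have hmom := fun m i => WTS.integrable_of_lintegral_ofReal_le (by fun_prop)
    (fun x => by positivity) (hK m i)
  have h4i := fun m i => (hmom m i).1
  have h4K := fun m i => (hmom m i).2
  have hS := WTS.tendsto_covEstimator_inProb hn hκ hnκ hY h4i h4K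
  obtain ⟨A, B, C, hAB, hBC, hC⟩ :=
    WTS.exists_whitening_factorization H (WTS.posDef_limitCov hV hκ)
  -- Both distributional limits come from this statement; the null hypothesis is `ν = 0`.
  have hlocal : ∀ ν : ((i : Fin a) × Fin (t i)) → ℝ,
      (∀ m, H *ᵥ μ m = (√(WTS.totalSize (n m) : ℝ))⁻¹ • (H *ᵥ ν)) →
      TendstoInDistribution (fun m ω => WTS.waldStat H (fun i k => Y m i k ω)) atTop
        (id : ℝ → ℝ) P
        (WTS.noncentralChiSq H.rank (WTS.noncentrality H (WTS.limitCov κ V) ν)) := by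
    intro ν hν
    -- Only `H μ` is prescribed, but `C = A * H` recovers `C μ` from it. Cancelling `√N` requires `N
    -- > 0`, hence large `m`; without groups all vectors are zero.
    have hη : ∀ᶠ m in atTop, √(WTS.totalSize (n m) : ℝ) • (C *ᵥ μ m) = C *ᵥ ν := by
      rcases isEmpty_or_nonempty (Fin a) with ha | ⟨⟨i⟩⟩
      · refine Eventually.of_forall fun m => ?_
        rw [Subsingleton.elim (μ m) 0, Subsingleton.elim ν 0, Matrix.mulVec_zero, smul_zero]
      · filter_upwards [(WTS.tendsto_totalSize hn i).eventually_gt_atTop 0] with m hm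
        have hAH : A * H = C :=
          calc A * H = A * (B * C) := by rw [hBC]
            _ = C := by rw [← Matrix.mul_assoc, hAB, Matrix.one_mul]
        have hN : √(WTS.totalSize (n m) : ℝ) ≠ 0 := (Real.sqrt_pos.2 (by exact_mod_cast hm)).ne'
        rw [← hAH, ← Matrix.mulVec_mulVec, hν m, Matrix.mulVec_smul, smul_inv_smul₀ hN,
          Matrix.mulVec_mulVec]
    have hX := WTS.tendstoInDistribution_sqrt_smul_stackedMean hn hκ hnκ hY h4i h4K hC
      (η := WithLp.toLp 2 (C *ᵥ ν)) hη
    have hnc : WTS.noncentrality H (WTS.limitCov κ V) ν = ‖WithLp.toLp 2 (C *ᵥ ν)‖ ^ 2 := by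
      rw [WTS.noncentrality_eq_of_factorization hAB hBC hC, EuclideanSpace.real_norm_sq_eq]
      simp [dotProduct, sq]
    rw [hnc]
    exact WTS.tendstoInDistribution_waldStat hY hS hAB hBC hC hX
  refine ⟨fun h0 => ?_, fun μ₀ hμ₀ hμ α _ => ?_, fun ν hν => ?_⟩
  · have hnull : TendstoInDistribution (fun m ω => WTS.waldStat H (fun i k => Y m i k ω)) atTop
        (id : ℝ → ℝ) P (WTS.noncentralChiSq H.rank 0) := by
      have h := hlocal 0 fun m => by rw [h0 m, Matrix.mulVec_zero, smul_zero]
      have hz : WTS.noncentrality H (WTS.limitCov κ V) 0 = 0 := by simp [WTS.noncentrality]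
      rwa [hz] at h
    refine ⟨?_, fun hH α hα => ?_, fun hH α hα m => ?_⟩
    · simpa only [WTS.noncentralChiSq_zero] using hnull
    · have h := WTS.tendsto_integral_waldTest hY hnull hα
      rwa [WTS.noncentralChiSq_zero, WTS.measureReal_chiSq_Ioi_criticalValue hH hα] at h
    · subst hH
      simp only [WTS.waldTest_zero hα, integral_zero]
  · have hmean := (WTS.tendsto_stackedMean_sub_inProb hn hY h4i).add_const μ₀
    simp only [hμ, sub_add_cancel, zero_add] at hmean
    exact WTS.tendsto_integral_waldTest_of_fixed_alternative hn hY hS hμ₀ hmean hAB hBC hC α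
  · exact ⟨hlocal ν hν, fun α hα => WTS.tendsto_integral_waldTest hY (hlocal ν hν) hα⟩
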